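/- Let $k$ be a field of characteristic zero and $R=k[x,y,z]$ with its standard grading. Let $$L_1=a_1x+a_2y+a_3z,\quad L_2=a_4x+a_5y+a_6z,\quad L_3=a_7x+a_8y+a_9z \qquad (a_i\in k)$$ be linear forms, let $$Q_1=xL_2-yL_1,\quad Q_2=xL_3-zL_1,\quad Q_3=yL_3-zL_2$$ be the $2\times 2$ minors of the matrix with rows $(x,y,z)$ and $(L_1,L_2,L_3)$, and let $f=\det\Theta$, where $\Theta$ is the $3\times 3$ Jacobian matrix of $Q_1,Q_2,Q_3$, whose $j$-th column consists of the partial derivatives of $Q_j$ with respect to $x,y,z$. Suppose that $f$ is non-zero and reduced, i.e. square-free. Let $J_f=(\partial f/\partial x,\partial f/\partial y,\partial f/\partial z)\subset R$ be the Jacobian ideal of $f$. Then the following assertions hold. (i) $J_f$ is of linear type, i.e. the canonical $R$-algebra epimorphism from the symmetric algebra ${\rm Sym}_RJ_f$ onto the Rees algebra $\mathscr{R}(J_f)=\bigoplus_{i\ge 0}J_f^it^i\subset R[t]$ is an isomorphism. In particular, the reduction number ${\rm r}(J_f)$ is $0$. Here ${\rm r}(I)$ is the minimum, over all ideals $K\subseteq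 I$ that are minimal with respect to inclusion among those with $I^{r+1}=KI^r$ for some $r\ge 0$, of the least such $r$. (ii) $\mathscr{R}(J_f)\cong{\rm Sym}_RJ_f$ is a complete intersection, i.e. it is isomorphic as a $k$-algebra to the quotient of a polynomial ring over $k$ in finitely many variables by an ideal generated by a regular sequence. (iii) The module ${\rm Der}_k(R/(f))$ of $k$-derivations of $R/(f)$ has Castelnuovo-Mumford regularity $1$ as a graded $R$-module. Here a derivation has degree $\delta$ if it maps the classes of $x,y,z$ to classes of forms of degree $\delta+1$, and the regularity is the maximum of all $a_{i,j}-i$ for a minimal graded free resolution with terms $F_i=\bigoplus_jR(-a_{i,j})$. -/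

import Mathlib

noncomputable section

open MvPolynomial

namespace FreeDiv

universe u v w

/-! ### Blowup algebras of an ideal -/

section Blowup

variable {R : Type u} [CommRing R]

/-- The canonical inclusion of `I` in degree one of the Rees algebra `⨁ Iⁱ tⁱ ⊆ R[t]`,
that is, `a ↦ a t`. -/
def toRees (I : Ideal R) : I →ₗ[R] reesAlgebra I where
  toFun a := ⟨Polynomial.monomial 1 (a : R), reesAlgebra.monomial_mem.mpr (by simp)⟩
  map_add' a b := by ext1; simp
  map_smul' r a := by ext1; simp [Polynomial.smul_monomial]

/-- The canonical `R`-algebra homomorphism from the symmetric algebra of the `R`-module `I` to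
the Rees algebra of `I`. -/
def symToRees (I : Ideal R) : SymmetricAlgebra R I →ₐ[R] reesAlgebra I :=
  SymmetricAlgebra.lift (toRees I)

/-- `I` is of linear type if the canonical map `Sym_R I → 𝓡(I)` is an isomorphism. -/
def IsLinearType (I : Ideal R) : Prop :=
  Function.Bijective (symToRees I)

/-- `K` is a reduction of `I`: `K ⊆ I` and `I ^ (r + 1) = K * I ^ r` for some `r ≥ 0`. -/
def IsReduction (I K : Ideal R) : Prop :=
  K ≤ I ∧ ∃ r : ℕ, I ^ (r + 1) = K * I ^ r

/-- A reduction of `I` that is minimal with respect to inclusion. -/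
def IsMinimalReduction (I K : Ideal R) : Prop :=
  Minimal (IsReduction I) K

/-- `r_K(I)`, the least `r` with `I ^ (r + 1) = K * I ^ r` (for a reduction `K` of `I`). -/
def reductionNumberWrt (I K : Ideal R) : ℕ :=
  sInf {r : ℕ | I ^ (r + 1) = K * I ^ r}

/-- The reduction number `r(I)`, the minimum of `r_K(I)` over the minimal reductions `K` of `I`.
It takes values in `ℕ∞`, so that it would be `⊤`, and not `0`, if there were no minimal
reduction. -/
def reductionNumber (I : Ideal R) : ℕ∞ :=
  ⨅ (K : Ideal R) (_ : IsMinimalReduction I K), (reductionNumberWrt I K : ℕ∞)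

end Blowup

/-- A `k`-algebra is a complete intersection if it is the quotient of a polynomial ring over `k`
in finitely many variables by an ideal that is generated by a regular sequence. -/
def IsCompleteIntersection (k : Type u) (A : Type v) [Field k] [CommRing A] [Algebra k A] :
    Prop :=
  ∃ (m : ℕ) (g : List (MvPolynomial (Fin m) k)),
    RingTheory.Sequence.IsRegular (MvPolynomial (Fin m) k) g ∧
      Nonempty (A ≃ₐ[k] (MvPolynomial (Fin m) k ⧸ Ideal.ofList g))

/-! ### Graded modules over a polynomial ring and Castelnuovo-Mumford regularity -/

section Regularity

variable {σ : Type u} {k : Type v} [Field k]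

/-- The degree `e` part of the standard graded polynomial ring, for an integer `e` (it is zero if
`e` is negative). -/
def homogPart (σ : Type u) (k : Type v) [Field k] (e : ℤ) : Submodule k (MvPolynomial σ k) where
  carrier := {p | ∀ m : σ →₀ ℕ, coeff m p ≠ 0 → (m.degree : ℤ) = e}
  zero_mem' := by intro m h; simp at h
  add_mem' := by
    intro p q hp hq m h
    by_cases h0 : coeff m p = 0
    · exact hq m (by simpa [h0] using h)
    · exact hp m h0
  smul_mem' := by
    intro c p hp m h
    exact hp m (by intro h0; simp [h0] at h)

/-- A finite minimal graded free resolution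
`0 → F_p → ⋯ → F_1 → F_0 → E → 0` with `F_i = ⨁_j R(-a_{i,j})`, of a module `E` over
`R = k[x_σ]` that is graded by `𝓔`. The `j`-th basis vector of `F_i` has degree `a_{i,j}`. -/
structure MinimalGradedFreeResolution (E : Type w) [AddCommGroup E] [Module k E]
    [Module (MvPolynomial σ k) E] (𝓔 : ℤ → Submodule k E) where
  /-- an index beyond which the free modules vanish -/
  length : ℕ
  /-- the ranks of the free modules -/
  rank : ℕ → ℕ
  /-- the degrees of the basis vectors -/
  shift : (i : ℕ) → Fin (rank i) → ℤ
  /-- the differentials `F_{i+1} → F_i` -/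
  d : (i : ℕ) → (Fin (rank (i + 1)) → MvPolynomial σ k) →ₗ[MvPolynomial σ k]
    (Fin (rank i) → MvPolynomial σ k)
  /-- the augmentation `F_0 → E` -/
  aug : (Fin (rank 0) → MvPolynomial σ k) →ₗ[MvPolynomial σ k] E
  rank_eq_zero : ∀ i, length < i → rank i = 0
  aug_surjective : Function.Surjective aug
  exact_aug : Function.Exact (d 0) aug
  exact_d : ∀ i, Function.Exact (d (i + 1)) (d i)
  aug_homogeneous : ∀ j, aug (Pi.single j 1) ∈ 𝓔 (shift 0 j)
  d_homogeneous : ∀ i j l,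
    d i (Pi.single j 1) l ∈ homogPart σ k (shift (i + 1) j - shift i l)
  /-- minimality: the entries of the differentials lie in the ideal of the variables -/
  minimal : ∀ i j l, constantCoeff (d i (Pi.single j 1) l) = 0

/-- The graded module `E` has Castelnuovo-Mumford regularity `r`: in a minimal graded free
resolution of `E`, the number `r` is the maximum of all `a_{i,j} - i`. (Minimal graded free
resolutions are unique up to isomorphism, so `r` is determined by `E`.) -/
def HasRegularity (E : Type w) [AddCommGroup E] [Module k E] [Module (MvPolynomial σ k) E]
    (𝓔 : ℤ → Submodule k E) (r : ℤ) : Prop :=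
  ∃ F : MinimalGradedFreeResolution (σ := σ) E 𝓔,
    IsGreatest {t : ℤ | ∃ (i : ℕ) (j : Fin (F.rank i)), t = F.shift i j - i} r

end Regularity

/-! ### Jacobian ideals and derivation modules of hypersurfaces -/

section Hypersurface

variable {σ : Type u} {k : Type v} [Field k]

/-- The Jacobian ideal of `f`, generated by its partial derivatives. -/
def jacobianIdeal (f : MvPolynomial σ k) : Ideal (MvPolynomial σ k) :=
  Ideal.span (Set.range fun i => pderiv i f)

/-- The coordinate ring `R/(f)`. -/
abbrev HypRing (f : MvPolynomial σ k) : Type _ :=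
  MvPolynomial σ k ⧸ Ideal.span {f}

/-- The module `Der_k(R/(f))`. -/
abbrev HypDer (f : MvPolynomial σ k) : Type _ :=
  Derivation k (HypRing f) (HypRing f)

/-- The degree `e` part of `Der_k(R/(f))`, for a homogeneous polynomial `f`: the derivations that
map the class of each variable to the class of a form of degree `e + 1`. These are the derivations
that are induced by the logarithmic derivations `∑ g_i ∂/∂x_i` of `f` with all `g_i` homogeneous
of degree `e + 1`. -/
def derGrading (f : MvPolynomial σ k) (e : ℤ) : Submodule k (HypDer f) where
  carrier := {D | ∀ i : σ, D (Ideal.Quotient.mk (Ideal.span {f}) (X i)) ∈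
    (homogPart σ k (e + 1)).map (Ideal.Quotient.mkₐ k (Ideal.span {f})).toLinearMap}
  zero_mem' := fun _ => Submodule.zero_mem _
  add_mem' := fun hD hD' i => Submodule.add_mem _ (hD i) (hD' i)
  smul_mem' := fun c _ hD i => Submodule.smul_mem _ c (hD i)

end Hypersurface

/-! ### The family of plane cubics -/

section Family

variable {k : Type v} [Field k]

/-- The linear forms `L_i = ∑_j a_{ij} x_j` in three variables. -/
def linForm (a : Matrix (Fin 3) (Fin 3) k) (i : Fin 3) : MvPolynomial (Fin 3) k :=
  ∑ j, C (a i j) * X j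

/-- The `2 × 2` minors `Q_1, Q_2, Q_3` of the matrix with rows `(x, y, z)` and
`(L_1, L_2, L_3)`. -/
def quadrics (a : Matrix (Fin 3) (Fin 3) k) : Fin 3 → MvPolynomial (Fin 3) k :=
  ![X 0 * linForm a 1 - X 1 * linForm a 0,
    X 0 * linForm a 2 - X 2 * linForm a 0,
    X 1 * linForm a 2 - X 2 * linForm a 1]

/-- The Jacobian matrix `Θ` of the quadrics `Q_1, Q_2, Q_3`. -/
def theta (a : Matrix (Fin 3) (Fin 3) k) : Matrix (Fin 3) (Fin 3) (MvPolynomial (Fin 3) k) :=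
  Matrix.of fun i j => pderiv i (quadrics a j)

/-- The cubic `f = det Θ`. -/
def cubic (a : Matrix (Fin 3) (Fin 3) k) : MvPolynomial (Fin 3) k :=
  (theta a).det

end Family

end FreeDiv

end

/-!
Let `A` be the matrix `a`. The cubic `f` is `-2 det (x, A x, A² x)` (`cubic_eq`). The linear
vector field attached to a matrix that commutes with `A` multiplies `f` by the trace of that
matrix (`sum_linForm_mul_pderiv_cubic`), so the trace-free parts of `A` and `A²` give two linear
syzygies of the partial derivatives of `f`, hence two bilinear equations of the Rees algebra of
the Jacobian ideal. The point is that these two equations generate all of them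
(`reesParam_eq_zero_iff`).

If the characteristic polynomial of `A` had a multiple root, then it would have one in `k`, as `k`
is perfect, and the adjugate of `A - c` for such a root `c` would provide a linear form whose
square divides `f` (`sq_linForm_dvd_det`). So, for reduced `f`, the matrix `A` is diagonalizable
with distinct eigenvalues over the algebraic closure, and `f` is a product of three independent
linear forms there. In the coordinates given by these forms the Jacobian ideal is `(yz, xz, xy)`,
whose Rees algebra is toric with the equations `x T₀ = y T₁ = z T₂`
(`mem_toricIdeal_of_reesParam_eq_zero`). The equations over `k` follow by faithfully flat descent
(`mem_of_map_mem_map`).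

All the assertions are consequences.
* The equations of the Rees algebra are generated by equations linear in `T`, so `J_f` is of
  linear type. An ideal of linear type has no proper reductions
  (`IsReduction.eq_of_isLinearType`), so the reduction number is zero.
* The ideal of the two equations is prime and contains no non-zero polynomial of degree less than
  two; hence the two quadratic generators have no common factor, and form a regular sequence
  (`isRelPrime_bilin`, `isRegular_pair`).
* The part of the equations that is linear in `T` is the syzygy module of the partial derivatives.
  Together with the Euler vector field, this shows that the logarithmic vector fields of `f` are
  generated by `x`, `A x` and `A² x` (`exists_saitoMatrix_mulVec_eq`). Their determinant is `f` up
  to a constant, so by Cramer's rule the relations modulo `f` are given by the adjugate matrix,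
  whose entries are quadrics. This is the resolution `0 → R(-2)³ → R³ → Der_k(R/(f)) → 0`.
-/

namespace FreeDiv

open MvPolynomial

/-! ### The toric case: the Rees algebra of `(yz, xz, xy)` -/

section Toric

variable {k : Type*} [Field k]

/-- The parametrisation `x_i ↦ x_i`, `T_i ↦ h_i t` of the Rees algebra of the ideal generated by
`h_0, h_1, h_2`. In the polynomial ring on the left, `Sum.inl i` is the variable `x_i` of the base
ring and `Sum.inr i` is the new variable `T_i`. -/
noncomputable def reesParam (h : Fin 3 → MvPolynomial (Fin 3) k) :
    MvPolynomial (Fin 3 ⊕ Fin 3) k →ₐ[k] Polynomial (MvPolynomial (Fin 3) k) :=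
  aeval (Sum.elim (fun i => Polynomial.C (X i)) fun i => Polynomial.X * Polynomial.C (h i))

/-- The products of two of the three variables. -/
noncomputable def pairProd (k : Type*) [Field k] : Fin 3 → MvPolynomial (Fin 3) k :=
  ![X 1 * X 2, X 0 * X 2, X 0 * X 1]

/-- The ideal of the relations `x₀T₀ = x₁T₁ = x₂T₂`. -/
noncomputable def toricIdeal (k : Type*) [Field k] : Ideal (MvPolynomial (Fin 3 ⊕ Fin 3) k) :=
  Ideal.span {X (Sum.inl 0) * X (Sum.inr 0) - X (Sum.inl 1) * X (Sum.inr 1),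
    X (Sum.inl 1) * X (Sum.inr 1) - X (Sum.inl 2) * X (Sum.inr 2)}

/-- A `k`-linear map backwards along `reesParam (pairProd k)`, with values in the quotient by
`toricIdeal k`. It sends `tⁿ x^c` to the only monomial
`∏ x_i ^ p_i T_i ^ q_i * (x₀T₀) ^ r` with `p_i q_i = 0` that can lie over it, which has
`p_i = c_i ∸ n` and `q_i = n ∸ c_i`. -/
noncomputable def toricSection (k : Type*) [Field k] :
    Polynomial (MvPolynomial (Fin 3) k) →ₗ[k]
      MvPolynomial (Fin 3 ⊕ Fin 3) k ⧸ toricIdeal k :=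
  Polynomial.lsum fun n => (basisMonomials (Fin 3) k).constr k fun c =>
    Ideal.Quotient.mk (toricIdeal k)
      (X (Sum.inl 0) ^ (c 0 - n) * X (Sum.inl 1) ^ (c 1 - n) * X (Sum.inl 2) ^ (c 2 - n) *
        (X (Sum.inr 0) ^ (n - c 0) * X (Sum.inr 1) ^ (n - c 1) * X (Sum.inr 2) ^ (n - c 2)) *
        (X (Sum.inl 0) * X (Sum.inr 0)) ^ (n - ((n - c 0) + (n - c 1) + (n - c 2))))

lemma toricSection_apply (n p q r : ℕ) :
    toricSection k (Polynomial.X ^ n * Polynomial.C (X 0 ^ p * X 1 ^ q * X 2 ^ r)) =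
    Ideal.Quotient.mk (toricIdeal k)
      (X (Sum.inl 0) ^ (p - n) * X (Sum.inl 1) ^ (q - n) * X (Sum.inl 2) ^ (r - n) *
        (X (Sum.inr 0) ^ (n - p) * X (Sum.inr 1) ^ (n - q) * X (Sum.inr 2) ^ (n - r)) *
        (X (Sum.inl 0) * X (Sum.inr 0)) ^ (n - ((n - p) + (n - q) + (n - r)))) := by
  have hm : (X 0 ^ p * X 1 ^ q * X 2 ^ r : MvPolynomial (Fin 3) k) =
      basisMonomials (Fin 3) k
        (Finsupp.single 0 p + Finsupp.single 1 q + Finsupp.single 2 r) := by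
    simp [X_pow_eq_monomial, monomial_mul]
  rw [mul_comm, Polynomial.C_mul_X_pow_eq_monomial, hm, toricSection, Polynomial.lsum_apply,
    Polynomial.sum_monomial_index _ _ (by simp), Module.Basis.constr_basis]
  simp

lemma pow_mul_pow_eq {A : Type*} [CommRing A] {u v w : A} (h : u * v = w) (a b : ℕ) :
    u ^ a * v ^ b = u ^ (a - b) * v ^ (b - a) * w ^ (min a b) := by
  rcases le_total a b with hab | hab
  · obtain ⟨c, rfl⟩ := Nat.exists_eq_add_of_le hab
    simp [← h, pow_add, mul_pow]; ring
  · obtain ⟨c, rfl⟩ := Nat.exists_eq_add_of_le hab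
    simp [← h, pow_add, mul_pow]; ring

lemma toricSection_reesParam (p : MvPolynomial (Fin 3 ⊕ Fin 3) k) :
    toricSection k (reesParam (pairProd k) p) = Ideal.Quotient.mk (toricIdeal k) p := by
  have key : (toricSection k).comp (reesParam (pairProd k)).toLinearMap =
      (Ideal.Quotient.mkₐ k (toricIdeal k)).toLinearMap := by
    refine (basisMonomials (Fin 3 ⊕ Fin 3) k).ext fun m => ?_
    set a := fun i => m (Sum.inl i) with ha
    set b := fun i => m (Sum.inr i) with hb
    have hm : basisMonomials (Fin 3 ⊕ Fin 3) k m =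
        X (Sum.inl 0) ^ a 0 * X (Sum.inl 1) ^ a 1 * X (Sum.inl 2) ^ a 2 *
        (X (Sum.inr 0) ^ b 0 * X (Sum.inr 1) ^ b 1 * X (Sum.inr 2) ^ b 2) := by
      change monomial m (1 : k) = _
      rw [monomial_eq, Finsupp.prod_fintype _ _ (by simp)]
      simp [Fintype.prod_sum_type, Fin.prod_univ_three, ha, hb]
    have hφ : reesParam (pairProd k) (basisMonomials (Fin 3 ⊕ Fin 3) k m) =
        Polynomial.X ^ (b 0 + b 1 + b 2) * Polynomial.C (X 0 ^ (a 0 + b 1 + b 2) *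
          X 1 ^ (a 1 + b 0 + b 2) * X 2 ^ (a 2 + b 0 + b 1)) := by
      rw [hm]
      simp only [reesParam, map_mul, map_pow, aeval_X, Sum.elim_inl, Sum.elim_inr, pairProd,
        Matrix.cons_val_zero, Matrix.cons_val_one, Matrix.cons_val]
      ring
    have h01 : Ideal.Quotient.mk (toricIdeal k) (X (Sum.inl 1)) *
        Ideal.Quotient.mk (toricIdeal k) (X (Sum.inr 1)) =
        Ideal.Quotient.mk (toricIdeal k) (X (Sum.inl 0)) *
        Ideal.Quotient.mk (toricIdeal k) (X (Sum.inr 0)) := by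
      rw [← map_mul, ← map_mul, eq_comm, Ideal.Quotient.eq]
      exact Ideal.subset_span (by simp)
    have h12 : Ideal.Quotient.mk (toricIdeal k) (X (Sum.inl 2)) *
        Ideal.Quotient.mk (toricIdeal k) (X (Sum.inr 2)) =
        Ideal.Quotient.mk (toricIdeal k) (X (Sum.inl 0)) *
        Ideal.Quotient.mk (toricIdeal k) (X (Sum.inr 0)) := by
      rw [← h01, ← map_mul, ← map_mul, eq_comm, Ideal.Quotient.eq]
      exact Ideal.subset_span (by simp)
    simp only [LinearMap.comp_apply, AlgHom.toLinearMap_apply, Ideal.Quotient.mkₐ_eq_mk]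
    rw [hφ, toricSection_apply, hm]
    generalize a 0 = a0, a 1 = a1, a 2 = a2, b 0 = b0, b 1 = b1, b 2 = b2
    simp only [map_mul, map_pow]
    have e0 := pow_mul_pow_eq (rfl : Ideal.Quotient.mk (toricIdeal k) (X (Sum.inl 0)) *
        Ideal.Quotient.mk (toricIdeal k) (X (Sum.inr 0)) = _) a0 b0
    have e1 := pow_mul_pow_eq h01 a1 b1
    have e2 := pow_mul_pow_eq h12 a2 b2
    have n0 : a0 + b1 + b2 - (b0 + b1 + b2) = a0 - b0 := by omega
    have n1 : a1 + b0 + b2 - (b0 + b1 + b2) = a1 - b1 := by omega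
    have n2 : a2 + b0 + b1 - (b0 + b1 + b2) = a2 - b2 := by omega
    have n3 : b0 + b1 + b2 - (a0 + b1 + b2) = b0 - a0 := by omega
    have n4 : b0 + b1 + b2 - (a1 + b0 + b2) = b1 - a1 := by omega
    have n5 : b0 + b1 + b2 - (a2 + b0 + b1) = b2 - a2 := by omega
    have n6 : b0 + b1 + b2 - (b0 - a0 + (b1 - a1) + (b2 - a2)) =
        min a0 b0 + min a1 b1 + min a2 b2 := by omega
    rw [n0, n1, n2, n3, n4, n5, n6]
    generalize Ideal.Quotient.mk (toricIdeal k) (X (Sum.inl 0)) = u0,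
      Ideal.Quotient.mk (toricIdeal k) (X (Sum.inl 1)) = u1,
      Ideal.Quotient.mk (toricIdeal k) (X (Sum.inl 2)) = u2,
      Ideal.Quotient.mk (toricIdeal k) (X (Sum.inr 0)) = v0,
      Ideal.Quotient.mk (toricIdeal k) (X (Sum.inr 1)) = v1,
      Ideal.Quotient.mk (toricIdeal k) (X (Sum.inr 2)) = v2 at e0 e1 e2 ⊢
    calc _ = (u0 ^ (a0 - b0) * v0 ^ (b0 - a0) * (u0 * v0) ^ min a0 b0) *
          (u1 ^ (a1 - b1) * v1 ^ (b1 - a1) * (u0 * v0) ^ min a1 b1) *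
          (u2 ^ (a2 - b2) * v2 ^ (b2 - a2) * (u0 * v0) ^ min a2 b2) := by ring
      _ = _ := by rw [← e0, ← e1, ← e2]; ring
  exact LinearMap.congr_fun key p

/-- The relations `x₀T₀ = x₁T₁ = x₂T₂` define the Rees algebra of `(x₁x₂, x₀x₂, x₀x₁)`. -/
lemma mem_toricIdeal_of_reesParam_eq_zero {p : MvPolynomial (Fin 3 ⊕ Fin 3) k}
    (hp : reesParam (pairProd k) p = 0) : p ∈ toricIdeal k := by
  rw [← Ideal.Quotient.eq_zero_iff_mem, ← toricSection_reesParam, hp, map_zero]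

end Toric

/-! ### Linear vector fields and the cubic -/

section LinearFields

variable {k : Type*} [Field k]

/-- The matrix with columns `x`, `a x`, `a² x`, where `x` is the vector of the variables. Its
columns are the coefficient vectors of the linear vector fields attached to `1`, `a` and `a²`. -/
noncomputable def saitoMatrix (a : Matrix (Fin 3) (Fin 3) k) :
    Matrix (Fin 3) (Fin 3) (MvPolynomial (Fin 3) k) :=
  Matrix.of fun i j => linForm (a ^ (j : ℕ)) i

lemma linForm_mul (a b : Matrix (Fin 3) (Fin 3) k) (i : Fin 3) :
    linForm (a * b) i = ∑ j, C (a i j) * linForm b j := by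
  simp only [linForm, Matrix.mul_apply, map_sum, map_mul, Finset.sum_mul, Finset.mul_sum]
  rw [Finset.sum_comm]
  simp only [mul_assoc]

lemma linForm_smul (c : k) (a : Matrix (Fin 3) (Fin 3) k) (i : Fin 3) :
    linForm (c • a) i = C c * linForm a i := by
  simp [linForm, Finset.mul_sum, mul_assoc]

lemma linForm_sub (a b : Matrix (Fin 3) (Fin 3) k) (i : Fin 3) :
    linForm (a - b) i = linForm a i - linForm b i := by
  simp [linForm, sub_mul, Finset.sum_sub_distrib]

@[simp]
lemma linForm_one (i : Fin 3) : linForm (1 : Matrix (Fin 3) (Fin 3) k) i = X i := by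
  simp [linForm, Matrix.one_apply]

lemma cubic_eq (a : Matrix (Fin 3) (Fin 3) k) : cubic a = -2 * (saitoMatrix a).det := by
  simp [cubic, theta, quadrics, linForm, saitoMatrix, Matrix.det_fin_three, Fin.sum_univ_three,
    pow_two, Matrix.mul_apply, pderiv_X]
  ring

lemma sum_mul_pderiv (h : Fin 3 → MvPolynomial (Fin 3) k) (p : MvPolynomial (Fin 3) k) :
    ∑ i, h i * pderiv i p = mkDerivation k h p := by
  have : ∑ i, h i • pderiv i = mkDerivation k h := by
    refine derivation_ext fun j => ?_
    fin_cases j <;> simp [Fin.sum_univ_three, pderiv_X]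
  rw [← this]
  simp [Fin.sum_univ_three]

/-- The linear vector field attached to a matrix which commutes with `a` multiplies
`det (x, a x, a² x)` by its trace: its flow is linear and commutes with `a`. -/
lemma sum_linForm_mul_pderiv_det {a m : Matrix (Fin 3) (Fin 3) k} (h : m * a = a * m) :
    ∑ i, linForm m i * pderiv i (saitoMatrix a).det = C m.trace * (saitoMatrix a).det := by
  have hD (i j : Fin 3) : mkDerivation k (linForm m) (saitoMatrix a i j) =
      ∑ l, C (m i l) * saitoMatrix a l j := by
    have hc : a ^ (j : ℕ) * m = m * a ^ (j : ℕ) := ((show Commute m a from h).pow_right _).symm.eq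
    simp only [saitoMatrix, Matrix.of_apply]
    rw [← linForm_mul, ← hc, linForm_mul]
    simp [linForm, Derivation.leibniz]
  rw [sum_mul_pderiv, Matrix.det_fin_three, Matrix.trace_fin_three]
  simp only [map_add, map_sub, Derivation.leibniz, hD, Fin.sum_univ_three, smul_eq_mul]
  ring

lemma sum_linForm_mul_pderiv_cubic {a m : Matrix (Fin 3) (Fin 3) k} (h : m * a = a * m) :
    ∑ i, linForm m i * pderiv i (cubic a) = C m.trace * cubic a := by
  have h2 : cubic a = C (-2) * (saitoMatrix a).det := by
    rw [cubic_eq, C_neg, map_ofNat]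
  have := congrArg (C (-2) * ·) (sum_linForm_mul_pderiv_det h)
  simp only [Finset.mul_sum] at this
  simp only [h2, pderiv_C_mul]
  rw [mul_left_comm, ← this]
  exact Finset.sum_congr rfl fun i _ => by ring

/-- If the rows of `P` are left eigenvectors of `a`, then `det (x, a x, a² x)` is a multiple of
the product of the linear forms given by the rows. -/
lemma det_mul_det_saitoMatrix {a P : Matrix (Fin 3) (Fin 3) k} {d : Fin 3 → k}
    (h : P * a = Matrix.diagonal d * P) :
    C P.det * (saitoMatrix a).det =
      C (Matrix.vandermonde d).det * ∏ i, linForm P i := by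
  have hpow (n : ℕ) : P * a ^ n = Matrix.diagonal (d ^ n) * P := by
    induction n with
    | zero => simp
    | succ n ih =>
      rw [pow_succ, ← mul_assoc, ih, mul_assoc, h, ← mul_assoc, Matrix.diagonal_mul_diagonal]
      simp only [pow_succ, Pi.pow_apply]
      rfl
  have hm : P.map C * saitoMatrix a =
      Matrix.diagonal (linForm P) * (Matrix.vandermonde d).map C := by
    ext1 i j
    rw [Matrix.diagonal_mul, Matrix.mul_apply]
    simp only [Matrix.map_apply, saitoMatrix, Matrix.of_apply, Matrix.vandermonde_apply]
    rw [← linForm_mul, hpow, linForm_mul]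
    simp [Matrix.diagonal_apply, mul_comm, apply_ite]
  have := congrArg Matrix.det hm
  rw [Matrix.det_mul, Matrix.det_mul, Matrix.det_diagonal] at this
  have e (M : Matrix (Fin 3) (Fin 3) k) : (M.map C).det = (C M.det : MvPolynomial (Fin 3) k) :=
    (RingHom.map_det C M).symm
  rw [e, e] at this
  rw [this, mul_comm]

end LinearFields

/-! ### A reduced cubic comes from a matrix with distinct eigenvalues -/

section Separable

variable {k : Type*} [Field k]

lemma adjugate_mul_adjugate {A : Type*} [CommRing A] (b : Matrix (Fin 3) (Fin 3) A) :
    b.adjugate * b.adjugate = b.adjugate.trace • b.adjugate + b.det • (b - b.trace • 1) := by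
  rw [Matrix.adjugate_fin_three, Matrix.det_fin_three]
  ext i j
  fin_cases i <;> fin_cases j <;>
    simp [Matrix.mul_apply, Fin.sum_univ_three, Matrix.trace_fin_three] <;> ring

/-- The adjugate of a singular `3 × 3` matrix has rank at most one. -/
lemma adjugate_mul_eq {A : Type*} [CommRing A] {b : Matrix (Fin 3) (Fin 3) A} (hb : b.det = 0)
    (i j l m : Fin 3) :
    b.adjugate i j * b.adjugate l m = b.adjugate l j * b.adjugate i m := by
  have h := Matrix.adjugate_adjugate b (by simp)
  rw [hb] at h
  generalize b.adjugate = n at h ⊢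
  rw [Matrix.adjugate_fin_three] at h
  have h' := fun i j => congrFun (congrFun h i) j
  have h00 := h' 0 0
  have h01 := h' 0 1
  have h02 := h' 0 2
  have h10 := h' 1 0
  have h11 := h' 1 1
  have h12 := h' 1 2
  have h20 := h' 2 0
  have h21 := h' 2 1
  have h22 := h' 2 2
  simp only [Matrix.of_apply, Matrix.cons_val_zero, Matrix.cons_val_one, Matrix.cons_val,
    Fintype.card_fin, Matrix.smul_apply, smul_eq_mul, ne_eq, one_ne_zero,
    not_false_eq_true, zero_pow, zero_mul, Nat.reduceSub] at h00 h01 h02 h10 h11 h12 h20 h21 h22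
  clear h' h hb
  have key (i l j m : Fin 3) (hil : i < l) (hjm : j < m) : n i j * n l m = n l j * n i m := by
    fin_cases i <;> fin_cases l <;> first
      | exact absurd hil (by decide)
      | fin_cases j <;> fin_cases m <;> first
          | exact absurd hjm (by decide)
          | simp only [Fin.zero_eta, Fin.mk_one, Fin.reduceFinMk]
            first
              | linear_combination h00 | linear_combination -h01 | linear_combination h02
              | linear_combination -h10 | linear_combination h11 | linear_combination -h12
              | linear_combination h20 | linear_combination -h21 | linear_combination h22
  rcases lt_trichotomy i l with hil | rfl | hil
  · rcases lt_trichotomy j m with hjm | rfl | hjm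
    · exact key i l j m hil hjm
    · exact mul_comm _ _
    · linear_combination -key i l m j hil hjm
  · rfl
  · rcases lt_trichotomy j m with hjm | rfl | hjm
    · linear_combination -key l i j m hil hjm
    · exact mul_comm _ _
    · linear_combination key l i m j hil hjm

lemma charpoly_fin_three (a : Matrix (Fin 3) (Fin 3) k) :
    a.charpoly = Polynomial.X ^ 3 - Polynomial.C a.trace * Polynomial.X ^ 2 +
      Polynomial.C a.adjugate.trace * Polynomial.X - Polynomial.C a.det := by
  simp [Matrix.charpoly, Matrix.det_fin_three, Matrix.trace_fin_three, Matrix.adjugate_fin_three]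
  ring

/-- Column operations replace `a` by `b = a - c` and `b²` by `adj b = b² - tr(b) b + tr(adj b)`. -/
lemma det_saitoMatrix_sub (a : Matrix (Fin 3) (Fin 3) k) (c : k) :
    (saitoMatrix a).det = (Matrix.of fun i (j : Fin 3) =>
      ![X i, linForm (a - c • 1) i, linForm (a - c • 1).adjugate i] j).det := by
  obtain ⟨b, rfl⟩ : ∃ b, a = b + c • 1 := ⟨a - c • 1, by simp⟩
  simp only [add_sub_cancel_right]
  simp [saitoMatrix, linForm, Matrix.det_fin_three, Fin.sum_univ_three, pow_two, Matrix.mul_apply,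
    Matrix.adjugate_fin_three]
  ring

/-- Cramer's rule, for a linear form `m`. -/
lemma cramer_fin_three {A : Type*} [CommRing A] (m u v w z : Fin 3 → A) :
    (∑ i, m i * z i) * (Matrix.of fun i (j : Fin 3) => ![u i, v i, w i] j).det =
      (∑ i, m i * u i) * (Matrix.of fun i (j : Fin 3) => ![z i, v i, w i] j).det +
      (∑ i, m i * v i) * (Matrix.of fun i (j : Fin 3) => ![u i, z i, w i] j).det +
      (∑ i, m i * w i) * (Matrix.of fun i (j : Fin 3) => ![u i, v i, z i] j).det := by
  simp [Matrix.det_fin_three, Fin.sum_univ_three]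
  ring

/-- If `c` is a multiple root of the characteristic polynomial of `a` and `N = adj (a - c)` is
non-zero, then each non-zero row `ℓ` of `N` gives a linear form whose square divides
`det (x, a x, a² x)`. In fact `N` has rank one, and `N (a - c) = 0` and `N² = 0`. -/
lemma sq_linForm_dvd_det {a : Matrix (Fin 3) (Fin 3) k} {c : k} (hdet : (a - c • 1).det = 0)
    (htr : (a - c • 1).adjugate.trace = 0) {i j : Fin 3} (hij : (a - c • 1).adjugate i j ≠ 0) :
    linForm (a - c • 1).adjugate i ^ 2 ∣ (saitoMatrix a).det := by
  rw [det_saitoMatrix_sub a c]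
  generalize hb : a - c • 1 = b at *
  have hrank := adjugate_mul_eq hdet
  have hNN := adjugate_mul_adjugate b
  rw [htr, hdet, zero_smul, zero_smul, add_zero] at hNN
  have hNb : b.adjugate * b = 0 := by rw [Matrix.adjugate_mul, hdet, zero_smul]
  generalize b.adjugate = N at *
  have h1 : C (N i j) * (Matrix.of fun i (j : Fin 3) => ![X i, linForm b i, linForm N i] j).det =
      linForm N i *
        (Matrix.of fun i (l : Fin 3) => ![X i, linForm b i, C (N i j)] l).det := by
    have e (l : Fin 3) : C (N i j) * linForm N l = C (N l j) * linForm N i := by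
      simp only [linForm, Finset.mul_sum, ← mul_assoc, ← C_mul, hrank i j l]
    simp only [Matrix.det_fin_three, Matrix.of_apply, Matrix.cons_val_zero, Matrix.cons_val_one,
      Matrix.cons_val]
    linear_combination (X 0 * linForm b 1 - X 1 * linForm b 0) * e 2 +
      (X 2 * linForm b 0 - X 0 * linForm b 2) * e 1 + (X 1 * linForm b 2 - X 2 * linForm b 1) * e 0
  have h2 := cramer_fin_three (fun l => C (N i l)) X (linForm b) (fun l => C (N l j))
    (fun l => C (if l = j then 1 else 0))
  have s1 : ∑ l, C (N i l) * X l = linForm N i := rfl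
  have s2 : ∑ l, C (N i l) * linForm b l = 0 := by rw [← linForm_mul, hNb]; simp [linForm]
  have s3 : ∑ l, (C (N i l) * C (N l j) : MvPolynomial (Fin 3) k) = 0 := by
    simp only [← C_mul, ← map_sum, ← Matrix.mul_apply, hNN]; simp
  have s4 : ∑ l, (C (N i l) * C (if l = j then 1 else 0) : MvPolynomial (Fin 3) k) = C (N i j) := by
    simp
  rw [s1, s2, s3, s4, zero_mul, zero_mul, add_zero, add_zero] at h2
  have hu : IsUnit (C (N i j) ^ 2 : MvPolynomial (Fin 3) k) :=
    ((Ne.isUnit hij).map C).pow 2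
  rw [← hu.dvd_mul_left, pow_two (C (N i j)), mul_assoc, h1, mul_left_comm, h2, pow_two,
    ← mul_assoc]
  exact dvd_mul_right _ _

lemma not_isUnit_linForm (a : Matrix (Fin 3) (Fin 3) k) (i : Fin 3) : ¬ IsUnit (linForm a i) := by
  intro h
  have := h.map constantCoeff
  simp [linForm] at this

lemma separable_charpoly_of_squarefree [CharZero k] {a : Matrix (Fin 3) (Fin 3) k}
    (hsq : Squarefree (cubic a)) : a.charpoly.Separable := by
  have hdvd : (saitoMatrix a).det ∣ cubic a := by rw [cubic_eq]; exact dvd_mul_left _ _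
  have h0 : (saitoMatrix a).det ≠ 0 := fun h => hsq.ne_zero (by rw [cubic_eq, h, mul_zero])
  rw [PerfectField.separable_iff_squarefree]
  intro p ⟨q, hq⟩
  by_contra hp
  have hχ0 : a.charpoly ≠ 0 := a.charpoly_monic.ne_zero
  have hp0 : p ≠ 0 := by rintro rfl; simp at hq; exact hχ0 hq
  have hq0 : q ≠ 0 := by rintro rfl; simp at hq; exact hχ0 hq
  have hdeg := a.charpoly_natDegree_eq_dim
  rw [hq, Polynomial.natDegree_mul (mul_ne_zero hp0 hp0) hq0, Polynomial.natDegree_mul hp0 hp0,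
    Fintype.card_fin] at hdeg
  have hp1 : p.natDegree ≠ 0 := fun h => hp (by
    rw [Polynomial.isUnit_iff_degree_eq_zero, Polynomial.degree_eq_natDegree hp0, h]; rfl)
  obtain ⟨c, hc⟩ := Polynomial.exists_root_of_degree_eq_one
    (p := p) (by rw [Polynomial.degree_eq_natDegree hp0, show p.natDegree = 1 by omega]; rfl)
  -- A root of `p` is at least a double root of the characteristic polynomial. The derivative of the
  -- latter at `c` is the trace of the adjugate of `a - c`.
  have e0 : a.charpoly.eval c = 0 := by simp [hq, hc.eq_zero]
  have e1 : a.charpoly.derivative.eval c = 0 := by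
    simp [hq, Polynomial.derivative_mul, hc.eq_zero]
  have hdet : (a - c • 1).det = 0 := by
    rw [Matrix.eval_charpoly] at e0
    rw [← neg_sub, Matrix.det_neg, Matrix.smul_one_eq_diagonal]
    exact mul_eq_zero_of_right _ e0
  have htr : (a - c • 1).adjugate.trace = 0 := by
    rw [charpoly_fin_three] at e1
    rw [← e1]
    simp [Matrix.adjugate_fin_three, Matrix.trace_fin_three]
    ring
  obtain ⟨i, j, hij⟩ : ∃ i j, (a - c • 1).adjugate i j ≠ 0 := by
    by_contra! h
    refine h0 ?_
    rw [det_saitoMatrix_sub a c]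
    simp [Matrix.det_fin_three, linForm, h]
  refine not_isUnit_linForm _ i (hsq (linForm (a - c • 1).adjugate i) ?_)
  rw [← pow_two]
  exact (sq_linForm_dvd_det hdet htr hij).trans hdvd

/-- Over an algebraically closed field, a `3 × 3` matrix with separable characteristic polynomial
is diagonalizable with distinct eigenvalues. -/
lemma exists_left_eigenbasis {K : Type*} [Field K] [IsAlgClosed K] {a : Matrix (Fin 3) (Fin 3) K}
    (ha : a.charpoly.Separable) :
    ∃ (P : Matrix (Fin 3) (Fin 3) K) (d : Fin 3 → K), Function.Injective d ∧ P.det ≠ 0 ∧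
      P * a = Matrix.diagonal d * P := by
  classical
  have hcard : a.charpoly.roots.toFinset.card = 3 := by
    rw [Multiset.toFinset_card_of_nodup (Polynomial.nodup_roots ha),
      IsAlgClosed.card_roots_eq_natDegree, a.charpoly_natDegree_eq_dim, Fintype.card_fin]
  let e := a.charpoly.roots.toFinset.equivFinOfCardEq hcard
  let d : Fin 3 → K := fun i => e.symm i
  have hd : Function.Injective d := Subtype.val_injective.comp e.symm.injective
  have hroot (i : Fin 3) : ∃ v, v ≠ 0 ∧ Matrix.vecMul v (Matrix.scalar (Fin 3) (d i) - a) = 0 := by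
    rw [Matrix.exists_vecMul_eq_zero_iff, ← Matrix.eval_charpoly]
    have := (e.symm i).2
    rw [Multiset.mem_toFinset] at this
    exact (Polynomial.mem_roots'.1 this).2
  choose v hv0 hv using hroot
  have hv' (i : Fin 3) : Matrix.vecMul (v i) a = d i • v i := by
    have := hv i
    rw [Matrix.vecMul_sub, sub_eq_zero] at this
    rw [← this]
    ext j
    simp [Matrix.vecMul_diagonal, mul_comm]
  have hli : LinearIndependent K v := by
    refine Module.End.eigenvectors_linearIndependent' (Matrix.toLin' a.transpose) d hd v
      fun i => ⟨?_, hv0 i⟩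
    rw [Module.End.mem_eigenspace_iff, Matrix.toLin'_apply, Matrix.mulVec_transpose, hv']
  refine ⟨Matrix.of v, d, hd, ?_, ?_⟩
  · have := Matrix.linearIndependent_rows_iff_isUnit.1
      (show LinearIndependent K (Matrix.of v).row from hli)
    exact ((Matrix.isUnit_iff_isUnit_det _).1 this).ne_zero
  · ext i j
    have := congrFun (hv' i) j
    rw [Matrix.diagonal_mul]
    exact this

end Separable

/-! ### The equations of the Rees algebra -/

section Equations

variable {k : Type*} [Field k]

/-- The bilinear form `∑ T_i (m x)_i` in the variables `x` and `T`. -/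
noncomputable def bilin (m : Matrix (Fin 3) (Fin 3) k) : MvPolynomial (Fin 3 ⊕ Fin 3) k :=
  ∑ i, ∑ j, C (m i j) * X (Sum.inl j) * X (Sum.inr i)

/-- Three times the trace-free part of `m`. -/
def traceFree (m : Matrix (Fin 3) (Fin 3) k) : Matrix (Fin 3) (Fin 3) k :=
  (3 : k) • m - m.trace • 1

/-- The ideal of the two bilinear equations given by the trace-free parts of `a` and `a²`. -/
noncomputable def reesIdeal (a : Matrix (Fin 3) (Fin 3) k) :
    Ideal (MvPolynomial (Fin 3 ⊕ Fin 3) k) :=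
  Ideal.span {bilin (traceFree a), bilin (traceFree (a ^ 2))}

lemma bilin_add (m n : Matrix (Fin 3) (Fin 3) k) : bilin (m + n) = bilin m + bilin n := by
  simp [bilin, add_mul, Finset.sum_add_distrib]

lemma bilin_smul (c : k) (m : Matrix (Fin 3) (Fin 3) k) : bilin (c • m) = C c * bilin m := by
  simp [bilin, Finset.mul_sum, mul_assoc]

/-- If `a` is diagonalized by `P`, then a matrix that is diagonalized by `P` and has trace zero is a
combination of the trace-free parts of `a` and `a²`: interpolate its eigenvalues by a polynomial
of degree at most two in those of `a`. -/
lemma exists_eq_combination_traceFree [CharZero k] {a P : Matrix (Fin 3) (Fin 3) k} {d : Fin 3 → k}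
    (hd : Function.Injective d) (hP : IsUnit P.det) (h : P * a = Matrix.diagonal d * P)
    {w : Fin 3 → k} (hw : ∑ i, w i = 0) :
    ∃ α β : k, P⁻¹ * Matrix.diagonal w * P = α • traceFree a + β • traceFree (a ^ 2) := by
  have hV : IsUnit (Matrix.vandermonde d).det :=
    (Matrix.det_vandermonde_ne_zero_iff.2 hd).isUnit
  set y := (Matrix.vandermonde d)⁻¹.mulVec w with hy
  have hyw (i : Fin 3) : y 0 + d i * y 1 + d i ^ 2 * y 2 = w i := by
    have : (Matrix.vandermonde d).mulVec y = w := by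
      rw [hy, Matrix.mulVec_mulVec, Matrix.mul_nonsing_inv _ hV, Matrix.one_mulVec]
    have := congrFun this i
    simpa [Matrix.mulVec, dotProduct, Fin.sum_univ_three, Matrix.vandermonde_apply] using this
  have ha : a = P⁻¹ * Matrix.diagonal d * P := by
    rw [mul_assoc, ← h, ← mul_assoc, Matrix.nonsing_inv_mul _ hP, one_mul]
  have ha2 : a ^ 2 = P⁻¹ * Matrix.diagonal (d ^ 2) * P := by
    rw [pow_two]
    nth_rewrite 1 [ha]
    rw [mul_assoc, h, mul_assoc, ← mul_assoc (Matrix.diagonal d), Matrix.diagonal_mul_diagonal,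
      mul_assoc]
    simp only [pow_two]
    rfl
  have htr (v : Fin 3 → k) : (P⁻¹ * Matrix.diagonal v * P).trace = ∑ i, v i := by
    rw [Matrix.trace_mul_comm, ← mul_assoc, Matrix.mul_nonsing_inv _ hP, one_mul,
      Matrix.trace_diagonal]
  refine ⟨y 1 / 3, y 2 / 3, ?_⟩
  have ht1 : a.trace = ∑ i, d i := by rw [← htr, ← ha]
  have ht2 : (a ^ 2).trace = ∑ i, d i ^ 2 := by rw [ha2, htr]; rfl
  have hdiag : Matrix.diagonal w = (y 1 / 3) • ((3 : k) • Matrix.diagonal d - (∑ i, d i) • 1) +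
      (y 2 / 3) • ((3 : k) • Matrix.diagonal (d ^ 2) - (∑ i, d i ^ 2) • 1) := by
    have h0 := hyw 0
    have h1 := hyw 1
    have h2 := hyw 2
    rw [Fin.sum_univ_three] at hw
    ext i j
    by_cases hij : i = j
    · subst hij
      simp [Fin.sum_univ_three]
      rw [← hyw i]
      linear_combination (1 / 3) * (hw + h0 + h1 + h2)
    · simp [hij]
  rw [hdiag, traceFree, traceFree, ht1, ht2, ha2]
  nth_rewrite 1 [ha]
  simp only [mul_add, add_mul, mul_sub, sub_mul, Matrix.mul_smul, Matrix.smul_mul, mul_one,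
    Matrix.nonsing_inv_mul _ hP]

/-- The equations of the Rees algebra of the Jacobian ideal of a product of three independent
linear forms: a linear change of coordinates reduces this to the toric case. -/
lemma mem_reesIdeal_of_diagonalizable [CharZero k] {a P : Matrix (Fin 3) (Fin 3) k} {d : Fin 3 → k}
    (hd : Function.Injective d) (hP : IsUnit P.det) (h : P * a = Matrix.diagonal d * P)
    {c : k} (hc : c ≠ 0) {f : MvPolynomial (Fin 3) k} (hf : f = C c * ∏ i, linForm P i)
    {p : MvPolynomial (Fin 3 ⊕ Fin 3) k} (hp : reesParam (fun i => pderiv i f) p = 0) :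
    p ∈ reesIdeal a := by
  have hPQ : P * P⁻¹ = 1 := Matrix.mul_nonsing_inv _ hP
  have hQP : P⁻¹ * P = 1 := Matrix.nonsing_inv_mul _ hP
  set Q := P⁻¹ with hQ
  -- The coordinates `P x` are paired with the dual coordinates `P⁻ᵀ T`; the factor `c⁻¹` is there
  -- because `T` stands for the derivatives of `c` times the product of the coordinates.
  let e : MvPolynomial (Fin 3 ⊕ Fin 3) k →ₐ[k] MvPolynomial (Fin 3 ⊕ Fin 3) k :=
    aeval (Sum.elim (fun i => ∑ j, C (P i j) * X (Sum.inl j))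
      fun i => C c⁻¹ * ∑ j, C (Q j i) * X (Sum.inr j))
  let e' : MvPolynomial (Fin 3 ⊕ Fin 3) k →ₐ[k] MvPolynomial (Fin 3 ⊕ Fin 3) k :=
    aeval (Sum.elim (fun i => ∑ j, C (Q i j) * X (Sum.inl j))
      fun i => C c * ∑ j, C (P j i) * X (Sum.inr j))
  let ψ : MvPolynomial (Fin 3) k →ₐ[k] MvPolynomial (Fin 3) k := aeval (linForm Q)
  have hee : e.comp e' = AlgHom.id k _ := by
    refine algHom_ext fun i => ?_
    rcases i with i | i
    · have : ∀ l, ∑ j, (C (Q i j) * C (P j l) : MvPolynomial (Fin 3 ⊕ Fin 3) k) =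
          C ((1 : Matrix (Fin 3) (Fin 3) k) i l) := fun l => by
        rw [← hQP, Matrix.mul_apply]; simp
      simp only [e, e', AlgHom.comp_apply, aeval_X, Sum.elim_inl, map_sum, map_mul, algHom_C,
        algebraMap_eq, Finset.mul_sum, ← mul_assoc, AlgHom.id_apply]
      rw [Finset.sum_comm]
      simp only [← Finset.sum_mul, this]
      simp [Matrix.one_apply]
    · have : ∀ l, ∑ j, (C (P j i) * C (Q l j) : MvPolynomial (Fin 3 ⊕ Fin 3) k) =
          C ((1 : Matrix (Fin 3) (Fin 3) k) l i) := fun l => by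
        rw [← hQP, Matrix.mul_apply]; simp [mul_comm]
      have hcc : (C c * C c⁻¹ : MvPolynomial (Fin 3 ⊕ Fin 3) k) = 1 := by
        rw [← C_mul, mul_inv_cancel₀ hc, C_1]
      simp only [e, e', AlgHom.comp_apply, aeval_X, Sum.elim_inr, map_sum, map_mul, algHom_C,
        algebraMap_eq, AlgHom.id_apply]
      simp only [mul_left_comm _ (C c⁻¹), ← Finset.mul_sum]
      rw [← mul_assoc, mul_comm (C c⁻¹), hcc, one_mul]
      simp only [Finset.mul_sum, ← mul_assoc]
      rw [Finset.sum_comm]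
      simp only [← Finset.sum_mul, this]
      simp [Matrix.one_apply]
  have hψP (i : Fin 3) : ψ (linForm P i) = X i := by
    have : ψ (linForm P i) = linForm (P * Q) i := by
      rw [linForm_mul]; simp [ψ, linForm, algHom_C]
    rw [this, hPQ, linForm_one]
  have hpd (i j : Fin 3) : pderiv i (linForm P j) = C (P j i) := by
    fin_cases i <;> simp [linForm, Fin.sum_univ_three, pderiv_X]
  have hψf (i : Fin 3) : ψ (pderiv i f) = C c * ∑ j, C (P j i) * pairProd k j := by
    rw [hf, pderiv_C_mul, Fin.prod_univ_three, Fin.sum_univ_three]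
    simp only [Derivation.leibniz, hpd, smul_eq_mul, map_mul, map_add, hψP, algHom_C,
      algebraMap_eq, pairProd, Matrix.cons_val_zero, Matrix.cons_val_one, Matrix.cons_val]
    ring
  have hcomm : (reesParam (pairProd k)).comp e' =
      (Polynomial.mapAlgHom ψ).comp (reesParam fun i => pderiv i f) := by
    refine algHom_ext fun i => ?_
    rcases i with i | i
    · simp [reesParam, e', ψ, linForm, algHom_C]
    · simp only [AlgHom.comp_apply, reesParam, e', hψf, aeval_X, Sum.elim_inr, map_mul, map_sum,
        algHom_C, Polynomial.coe_mapAlgHom, Polynomial.map_X,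
        Polynomial.map_C, RingHom.coe_coe]
      have hC (r : k) : algebraMap k (Polynomial (MvPolynomial (Fin 3) k)) r =
          Polynomial.C (C r) := rfl
      simp only [Finset.mul_sum, hC]
      exact Finset.sum_congr rfl fun _ _ => by ring
  have h0 : reesParam (pairProd k) (e' p) = 0 := by
    have := DFunLike.congr_fun hcomm p
    simp only [AlgHom.comp_apply, hp, map_zero] at this
    exact this
  have hpe : p = e (e' p) := (DFunLike.congr_fun hee p).symm
  have hbil (w : Fin 3 → k) : e (∑ i, C (w i) * (X (Sum.inl i) * X (Sum.inr i))) =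
      C c⁻¹ * bilin (Q * Matrix.diagonal w * P) := by
    simp only [e, map_add, map_mul, algHom_C, aeval_X, bilin, Matrix.mul_apply, algebraMap_eq,
      Sum.elim_inl, Sum.elim_inr, Fin.sum_univ_three, Matrix.diagonal_apply]
    simp
    ring
  have hgen (w : Fin 3 → k) (hw : ∑ i, w i = 0) :
      e (∑ i, C (w i) * (X (Sum.inl i) * X (Sum.inr i))) ∈ reesIdeal a := by
    obtain ⟨α, β, hαβ⟩ := exists_eq_combination_traceFree hd hP h hw
    rw [hbil, hαβ, bilin_add, bilin_smul, bilin_smul]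
    refine Ideal.mul_mem_left _ _ (Ideal.add_mem _ (Ideal.mul_mem_left _ _ ?_)
      (Ideal.mul_mem_left _ _ ?_)) <;> exact Ideal.subset_span (by simp)
  have hle : (toricIdeal k).map e ≤ reesIdeal a := by
    rw [toricIdeal, Ideal.map_span, Ideal.span_le]
    rintro _ ⟨q, hq, rfl⟩
    rcases hq with rfl | rfl
    · convert hgen ![1, -1, 0] (by simp [Fin.sum_univ_three]) using 2
      simp [Fin.sum_univ_three, sub_eq_add_neg]
    · convert hgen ![0, 1, -1] (by simp [Fin.sum_univ_three]) using 2
      simp [Fin.sum_univ_three, sub_eq_add_neg]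
  rw [hpe]
  exact hle (Ideal.mem_map_of_mem e (mem_toricIdeal_of_reesParam_eq_zero h0))

end Equations

/-! ### Descent to the ground field -/

section Descent

variable {k K : Type*} [Field k] [Field K]

lemma map_linForm (φ : k →+* K) (a : Matrix (Fin 3) (Fin 3) k) (i : Fin 3) :
    map φ (linForm a i) = linForm (φ.mapMatrix a) i := by
  simp [linForm]

lemma map_det_saitoMatrix (φ : k →+* K) (a : Matrix (Fin 3) (Fin 3) k) :
    map φ (saitoMatrix a).det = (saitoMatrix (φ.mapMatrix a)).det := by
  rw [RingHom.map_det]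
  congr 1
  ext1 i j
  simp only [RingHom.mapMatrix_apply, Matrix.map_apply, saitoMatrix, Matrix.of_apply, map_linForm]
  rw [← RingHom.mapMatrix_apply, map_pow, RingHom.mapMatrix_apply]

lemma map_bilin (φ : k →+* K) (a : Matrix (Fin 3) (Fin 3) k) :
    map φ (bilin a) = bilin (φ.mapMatrix a) := by
  simp [bilin]

lemma map_traceFree (φ : k →+* K) (a : Matrix (Fin 3) (Fin 3) k) :
    φ.mapMatrix (traceFree a) = traceFree (φ.mapMatrix a) := by
  ext i j
  simp [traceFree, Matrix.trace_fin_three, Matrix.one_apply]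
  split_ifs <;> simp [show φ 3 = 3 from map_ofNat φ 3]

lemma map_reesParam (φ : k →+* K) (h : Fin 3 → MvPolynomial (Fin 3) k)
    (p : MvPolynomial (Fin 3 ⊕ Fin 3) k) :
    reesParam (fun i => map φ (h i)) (map φ p) = Polynomial.map (map φ) (reesParam h p) := by
  induction p using MvPolynomial.induction_on with
  | C c => simp [reesParam, algHom_C]
  | add p q hp hq => simp only [map_add, hp, hq, Polynomial.map_add]
  | mul_X p i hp =>
    simp only [map_mul, hp, Polynomial.map_mul, map_X]
    congr 1
    rcases i with i | i <;> simp [reesParam]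

attribute [local instance] algebraMvPolynomial in
/-- Ideal membership descends along an extension of the coefficient field, since the extension of
polynomial rings is free, hence faithfully flat. -/
lemma mem_of_map_mem_map {σ : Type*} [Algebra k K] {I : Ideal (MvPolynomial σ k)}
    {p : MvPolynomial σ k} (hp : map (algebraMap k K) p ∈ I.map (map (algebraMap k K))) :
    p ∈ I := by
  have hbc : IsBaseChange (MvPolynomial σ k)
      (IsScalarTower.toAlgHom k K (MvPolynomial σ K)).toLinearMap := Algebra.IsPushout.out
  have : Module.Free (MvPolynomial σ k) (MvPolynomial σ K) := hbc.free
  rw [← Ideal.comap_map_eq_self_of_faithfullyFlat (B := MvPolynomial σ K) I]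
  exact hp

/-- The equations of the Rees algebra of the Jacobian ideal of a reduced cubic `f` of the family. -/
lemma mem_reesIdeal_of_reesParam_eq_zero [CharZero k] {a : Matrix (Fin 3) (Fin 3) k}
    (hsq : Squarefree (cubic a)) {p : MvPolynomial (Fin 3 ⊕ Fin 3) k}
    (hp : reesParam (fun i => pderiv i (cubic a)) p = 0) : p ∈ reesIdeal a := by
  let φ := algebraMap k (AlgebraicClosure k)
  have : CharZero (AlgebraicClosure k) := charZero_of_injective_algebraMap φ.injective
  have hsep := separable_charpoly_of_squarefree hsq
  obtain ⟨P, d, hd, hP, hPa⟩ := exists_left_eigenbasis (a := φ.mapMatrix a) (by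
    rw [RingHom.mapMatrix_apply, Matrix.charpoly_map]; exact hsep.map)
  have hdet := det_mul_det_saitoMatrix hPa
  have hf : map φ (cubic a) =
      C (-2 * (P.det⁻¹ * (Matrix.vandermonde d).det)) * ∏ i, linForm P i := by
    have hPP : (C P.det⁻¹ * C P.det : MvPolynomial (Fin 3) (AlgebraicClosure k)) = 1 := by
      rw [← C_mul, inv_mul_cancel₀ hP, C_1]
    rw [cubic_eq, map_mul, map_det_saitoMatrix]
    simp only [C_mul, map_neg, map_ofNat, mul_assoc, ← hdet]
    rw [← mul_assoc (C _), hPP, one_mul]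
  refine mem_of_map_mem_map (K := AlgebraicClosure k) ?_
  have := mem_reesIdeal_of_diagonalizable hd hP.isUnit hPa (by
    simp [hP, Matrix.det_vandermonde_ne_zero_iff.2 hd]) hf (p := map φ p) (by
    simp only [pderiv_map]
    rw [map_reesParam, hp, Polynomial.map_zero])
  rw [reesIdeal, ← map_pow, ← map_traceFree, ← map_traceFree, ← map_bilin, ← map_bilin] at this
  rw [reesIdeal, Ideal.map_span, Set.image_pair]
  exact this

end Descent

/-! ### Linear type -/

section LinearType

/-- An ideal of linear type has no proper reductions. By linear type, every linear form `φ` on `I`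
with values in a residue field `κ` extends to a homomorphism from the Rees algebra to `κ[T]` with
`a t ↦ φ(a) T`. If `K` is a proper reduction, then there is a non-zero `φ` that vanishes on `K`. Its
extension kills `K I ^ r tʳ⁺¹`, but not `I ^ (r + 1) tʳ⁺¹`. -/
lemma IsReduction.eq_of_isLinearType {R : Type*} [CommRing R] {I K : Ideal R} (hfg : I.FG)
    (hI : IsLinearType I) (hK : IsReduction I K) : K = I := by
  obtain ⟨hKI, r, hr⟩ := hK
  by_contra hne
  have hfin : Module.Finite R I := Module.Finite.iff_fg.2 hfg
  have htop : Submodule.comap I.subtype K ≠ ⊤ := fun h => hne (le_antisymm hKI fun x hx => by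
    have : (⟨x, hx⟩ : I) ∈ Submodule.comap I.subtype K := h ▸ Submodule.mem_top
    exact this)
  -- A simple quotient of `I / K` supplies the linear form.
  obtain ⟨N, hN, hKN⟩ :=
    (eq_top_or_exists_le_coatom (Submodule.comap I.subtype K)).resolve_left htop
  obtain ⟨m, hm, ⟨e⟩⟩ := isSimpleModule_iff_quot_maximal.1 (isSimpleModule_iff_isCoatom.2 hN)
  let φ : I →ₗ[R] R ⧸ m := e.toLinearMap.comp N.mkQ
  have hφ : Function.Surjective φ := e.surjective.comp N.mkQ_surjective
  have hφK (x : I) (hx : (x : R) ∈ K) : φ x = 0 := by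
    have : N.mkQ x = 0 := by
      rw [Submodule.mkQ_apply, Submodule.Quotient.mk_eq_zero]
      exact hKN hx
    simp only [φ, LinearMap.comp_apply, this, map_zero]
  let Θ : SymmetricAlgebra R I →ₐ[R] Polynomial (R ⧸ m) :=
    SymmetricAlgebra.lift (((Polynomial.monomial 1).restrictScalars R).comp φ)
  let E := AlgEquiv.ofBijective (symToRees I) hI
  let Ψ : reesAlgebra I →ₐ[R] Polynomial (R ⧸ m) := Θ.comp E.symm.toAlgHom
  have hΨ (x : I) : Ψ (toRees I x) = Polynomial.monomial 1 (φ x) := by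
    have : E.symm (toRees I x) = SymmetricAlgebra.ι R I x := by
      rw [AlgEquiv.symm_apply_eq]
      exact (SymmetricAlgebra.lift_ι_apply (toRees I) x).symm
    change Θ (E.symm (toRees I x)) = _
    rw [this, SymmetricAlgebra.lift_ι_apply]
    rfl
  have hvanish (b : R) (hb : b ∈ K * I ^ r) :
      ∃ x : reesAlgebra I, (x : Polynomial R) = Polynomial.monomial (r + 1) b ∧ Ψ x = 0 := by
    refine Submodule.mul_induction_on hb (fun c hc d hd => ?_) ?_
    · refine ⟨toRees I ⟨c, hKI hc⟩ * ⟨Polynomial.monomial r d, reesAlgebra.monomial_mem.2 hd⟩,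
        ?_, ?_⟩
      · simp [toRees, Polynomial.monomial_mul_monomial, add_comm]
      · rw [map_mul, hΨ, hφK _ hc, map_zero, zero_mul]
    · rintro c d ⟨x, hx, hx0⟩ ⟨y, hy, hy0⟩
      exact ⟨x + y, by simp [hx, hy], by simp [hx0, hy0]⟩
  obtain ⟨x, hx⟩ := hφ 1
  obtain ⟨y, hy, hy0⟩ := hvanish ((x : R) ^ (r + 1)) (hr ▸ Ideal.pow_mem_pow x.2 _)
  have hxy : y = toRees I x ^ (r + 1) := by
    ext1
    simp [hy, toRees, Polynomial.monomial_pow]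
  rw [hxy, map_pow, hΨ, hx, Polynomial.monomial_pow] at hy0
  have : Nontrivial (R ⧸ m) := Ideal.Quotient.nontrivial_iff.2 hm.ne_top
  simp at hy0

lemma reductionNumber_eq_zero_of_isLinearType {R : Type*} [CommRing R] {I : Ideal R} (hfg : I.FG)
    (hI : IsLinearType I) : reductionNumber I = 0 := by
  have hmin : IsMinimalReduction I I :=
    ⟨⟨le_rfl, 0, by simp⟩, fun K hK _ => (hK.eq_of_isLinearType hfg hI).ge⟩
  have h0 : reductionNumberWrt I I = 0 := Nat.sInf_eq_zero.2 (Or.inl (by simp))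
  refine le_antisymm ?_ bot_le
  exact (iInf₂_le I hmin).trans (by simp [h0])

variable {k : Type*} [Field k]

/-- The presentation of the symmetric algebra of the ideal generated by `h_0, h_1, h_2` as a
quotient of the polynomial ring in the variables `x_i` and `T_i`. -/
noncomputable def symParam (h : Fin 3 → MvPolynomial (Fin 3) k) :
    MvPolynomial (Fin 3 ⊕ Fin 3) k →+*
      SymmetricAlgebra (MvPolynomial (Fin 3) k) (Ideal.span (Set.range h)) :=
  eval₂Hom ((algebraMap (MvPolynomial (Fin 3) k) _).comp C)
    (Sum.elim (fun i => algebraMap (MvPolynomial (Fin 3) k) _ (X i))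
      fun i => SymmetricAlgebra.ι _ _ ⟨h i, Ideal.subset_span ⟨i, rfl⟩⟩)

lemma symToRees_symParam (h : Fin 3 → MvPolynomial (Fin 3) k)
    (p : MvPolynomial (Fin 3 ⊕ Fin 3) k) :
    (symToRees _ (symParam h p) : Polynomial (MvPolynomial (Fin 3) k)) = reesParam h p := by
  have : ((reesAlgebra (Ideal.span (Set.range h))).val.toRingHom.comp
      ((symToRees _).toRingHom.comp (symParam h))) = (reesParam h).toRingHom := by
    refine MvPolynomial.ringHom_ext (fun c => ?_) fun i => ?_
    · simp [symParam, reesParam, algHom_C]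
    · rcases i with i | i
      · simp [symParam, reesParam]
      · simp [symParam, reesParam, symToRees, toRees]
        rw [← Polynomial.C_mul_X_eq_monomial, mul_comm]
  exact DFunLike.congr_fun this p

lemma symParam_rename (h : Fin 3 → MvPolynomial (Fin 3) k) (p : MvPolynomial (Fin 3) k) :
    symParam h (rename Sum.inl p) = algebraMap _ _ p := by
  have : (symParam h).comp (rename Sum.inl : MvPolynomial (Fin 3) k →ₐ[k] _).toRingHom =
      algebraMap _ _ := by
    refine MvPolynomial.ringHom_ext (fun c => ?_) fun i => ?_ <;> simp [symParam]
  exact DFunLike.congr_fun this p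

lemma symParam_sum (h g : Fin 3 → MvPolynomial (Fin 3) k) :
    symParam h (∑ i, rename Sum.inl (g i) * X (Sum.inr i)) =
      SymmetricAlgebra.ι _ _ ⟨∑ i, g i * h i, Ideal.sum_mem _ fun i _ =>
        Ideal.mul_mem_left _ _ (Ideal.subset_span ⟨i, rfl⟩)⟩ := by
  have e : (⟨∑ i, g i * h i, Ideal.sum_mem _ fun i _ =>
        Ideal.mul_mem_left _ _ (Ideal.subset_span ⟨i, rfl⟩)⟩ : Ideal.span (Set.range h)) =
      ∑ i, g i • ⟨h i, Ideal.subset_span ⟨i, rfl⟩⟩ := by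
    ext1; simp
  rw [e, map_sum, map_sum]
  refine Finset.sum_congr rfl fun i _ => ?_
  rw [map_mul, symParam_rename, map_smul, Algebra.smul_def]
  simp [symParam]

lemma symParam_surjective (h : Fin 3 → MvPolynomial (Fin 3) k) :
    Function.Surjective (symParam h) := by
  intro s
  induction s using SymmetricAlgebra.induction with
  | algebraMap r => exact ⟨_, symParam_rename h r⟩
  | ι x =>
    obtain ⟨x, hx⟩ := x
    obtain ⟨g, rfl⟩ := (Submodule.mem_span_range_iff_exists_fun _).1 hx
    exact ⟨_, symParam_sum h g⟩
  | mul a b ha hb =>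
    obtain ⟨p, rfl⟩ := ha
    obtain ⟨q, rfl⟩ := hb
    exact ⟨p * q, map_mul _ _ _⟩
  | add a b ha hb =>
    obtain ⟨p, rfl⟩ := ha
    obtain ⟨q, rfl⟩ := hb
    exact ⟨p + q, map_add _ _ _⟩

lemma symToRees_surjective {R : Type*} [CommRing R] (I : Ideal R) :
    Function.Surjective (symToRees I) := by
  rw [← AlgHom.range_eq_top, eq_top_iff]
  rintro ⟨p, hp⟩ -
  have hle : reesAlgebra I ≤ (symToRees I).range.map (reesAlgebra I).val := by
    refine (adjoin_monomial_eq_reesAlgebra I).ge.trans (Algebra.adjoin_le_iff.2 ?_)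
    rintro _ ⟨x, hx, rfl⟩
    exact ⟨toRees I ⟨x, hx⟩, ⟨SymmetricAlgebra.ι _ _ ⟨x, hx⟩,
      SymmetricAlgebra.lift_ι_apply (toRees I) _⟩, rfl⟩
  obtain ⟨q, hq, hqp⟩ := hle hp
  rwa [show (⟨p, hp⟩ : reesAlgebra I) = q from Subtype.ext hqp.symm]

/-- If the equations of the Rees algebra already hold in the symmetric algebra, then the ideal
is of linear type. -/
lemma isLinearType_of_forall_symParam_eq_zero {h : Fin 3 → MvPolynomial (Fin 3) k}
    (hker : ∀ p, reesParam h p = 0 → symParam h p = 0) :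
    IsLinearType (Ideal.span (Set.range h)) := by
  refine ⟨(injective_iff_map_eq_zero _).2 fun s hs => ?_, symToRees_surjective _⟩
  obtain ⟨p, rfl⟩ := symParam_surjective h s
  exact hker p (by rw [← symToRees_symParam, hs]; rfl)

lemma bilin_eq_sum (m : Matrix (Fin 3) (Fin 3) k) :
    bilin m = ∑ i, rename Sum.inl (linForm m i) * X (Sum.inr i) := by
  simp [bilin, linForm, Finset.sum_mul]

/-- The bilinear equations come from the logarithmic vector fields which annihilate the cubic. -/
lemma sum_linForm_traceFree_mul_pderiv {a m : Matrix (Fin 3) (Fin 3) k} (h : m * a = a * m) :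
    ∑ i, linForm (traceFree m) i * pderiv i (cubic a) = 0 := by
  have h1 := sum_linForm_mul_pderiv_cubic h
  have h2 := sum_linForm_mul_pderiv_cubic (a := a) (m := 1) (by simp)
  simp only [traceFree, linForm_sub, linForm_smul, sub_mul, mul_assoc, Finset.sum_sub_distrib,
    ← Finset.mul_sum, h1, h2]
  simp only [Matrix.trace_one, Fintype.card_fin, Nat.cast_ofNat]
  ring

lemma symParam_eq_zero_of_mem_reesIdeal {a : Matrix (Fin 3) (Fin 3) k}
    {p : MvPolynomial (Fin 3 ⊕ Fin 3) k} (hp : p ∈ reesIdeal a) :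
    symParam (fun i => pderiv i (cubic a)) p = 0 := by
  have hb {m : Matrix (Fin 3) (Fin 3) k} (h : m * a = a * m) :
      symParam (fun i => pderiv i (cubic a)) (bilin (traceFree m)) = 0 := by
    rw [bilin_eq_sum, symParam_sum]
    simp only [sum_linForm_traceFree_mul_pderiv h]
    exact map_zero _
  have : reesIdeal a ≤ RingHom.ker (symParam fun i => pderiv i (cubic a)) := by
    rw [reesIdeal, Ideal.span_le]
    rintro _ (rfl | rfl)
    · exact hb rfl
    · exact hb (pow_mul_comm' a 2)
  exact this hp

lemma reesParam_eq_zero_iff [CharZero k] {a : Matrix (Fin 3) (Fin 3) k}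
    (hsq : Squarefree (cubic a)) {p : MvPolynomial (Fin 3 ⊕ Fin 3) k} :
    reesParam (fun i => pderiv i (cubic a)) p = 0 ↔ p ∈ reesIdeal a := by
  refine ⟨mem_reesIdeal_of_reesParam_eq_zero hsq, fun hp => ?_⟩
  rw [← symToRees_symParam, symParam_eq_zero_of_mem_reesIdeal hp, map_zero]
  rfl

lemma isLinearType_jacobianIdeal [CharZero k] {a : Matrix (Fin 3) (Fin 3) k}
    (hsq : Squarefree (cubic a)) : IsLinearType (jacobianIdeal (cubic a)) :=
  isLinearType_of_forall_symParam_eq_zero fun _ hp =>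
    symParam_eq_zero_of_mem_reesIdeal ((reesParam_eq_zero_iff hsq).1 hp)

end LinearType

/-! ### The Rees algebra is a complete intersection -/

section CompleteIntersection

lemma isRegular_pair {S : Type*} [CommRing S] [IsDomain S] [UniqueFactorizationMonoid S] {g h : S}
    (hg : g ≠ 0) (hgh : IsRelPrime g h) (htop : Ideal.span {g, h} ≠ ⊤) :
    RingTheory.Sequence.IsRegular S [g, h] := by
  refine ⟨?_, ?_⟩
  · rw [RingTheory.Sequence.isWeaklyRegular_cons_iff,
      RingTheory.Sequence.isWeaklyRegular_singleton_iff]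
    refine ⟨fun x y hxy => mul_left_cancel₀ hg hxy, ?_⟩
    rw [isSMulRegular_iff_right_eq_zero_of_smul]
    intro x hx
    obtain ⟨x, rfl⟩ := Submodule.Quotient.mk_surjective _ x
    rw [← Submodule.Quotient.mk_smul, Submodule.Quotient.mk_eq_zero,
      Submodule.mem_smul_pointwise_iff_exists] at hx
    rw [Submodule.Quotient.mk_eq_zero, Submodule.mem_smul_pointwise_iff_exists]
    obtain ⟨y, -, hy⟩ := hx
    obtain ⟨z, hz⟩ := hgh.dvd_of_dvd_mul_left (Dvd.intro y hy : g ∣ h * x)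
    exact ⟨z, Submodule.mem_top, hz.symm⟩
  · intro h
    refine htop ?_
    simpa [Ideal.ofList_cons, Ideal.span_insert] using h.symm

variable {k : Type*} [Field k]

lemma isHomogeneous_bilin (m : Matrix (Fin 3) (Fin 3) k) : (bilin m).IsHomogeneous 2 :=
  IsHomogeneous.sum _ _ _ fun i _ => IsHomogeneous.sum _ _ _ fun j _ =>
    ((isHomogeneous_C _ (m i j)).mul (isHomogeneous_X k (Sum.inl j))).mul
      (isHomogeneous_X k (Sum.inr i))

/-- Setting `T` equal to the `i`-th basis vector turns `∑ T_i (m x)_i` into `(m x)_i`. -/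
lemma aeval_bilin (m : Matrix (Fin 3) (Fin 3) k) (i : Fin 3) :
    aeval (Sum.elim X (Pi.single i 1) : Fin 3 ⊕ Fin 3 → MvPolynomial (Fin 3) k) (bilin m) =
      linForm m i := by
  simp [bilin, linForm, Pi.single_apply, algHom_C]

/-- The two equations are linearly independent: a relation would make `x`, `a x` and `a² x`
linearly dependent. -/
lemma eq_zero_of_combination_bilin_eq_zero {a : Matrix (Fin 3) (Fin 3) k} [CharZero k]
    (h0 : cubic a ≠ 0) {α β : k}
    (h : C α * bilin (traceFree a) + C β * bilin (traceFree (a ^ 2)) = 0) : α = 0 ∧ β = 0 := by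
  have hdet : (saitoMatrix a).det ≠ 0 := fun h => h0 (by rw [cubic_eq, h, mul_zero])
  have hv : (saitoMatrix a).mulVec
      ![C (-(α * a.trace) - β * (a ^ 2).trace), C (3 * α), C (3 * β)] = 0 := by
    ext1 i
    have := congrArg (aeval (Sum.elim X (Pi.single i 1) :
      Fin 3 ⊕ Fin 3 → MvPolynomial (Fin 3) k)) h
    simp only [map_add, map_mul, algHom_C, algebraMap_eq, aeval_bilin, map_zero, traceFree,
      linForm_sub, linForm_smul, linForm_one] at this
    simp [Matrix.mulVec, dotProduct, Fin.sum_univ_three, saitoMatrix] at this ⊢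
    linear_combination this
  have := Matrix.eq_zero_of_mulVec_eq_zero hdet hv
  have h1 := congrFun this 1
  have h2 := congrFun this 2
  simpa using And.intro h1 h2

lemma coeff_eq_zero_of_mem_reesIdeal {a : Matrix (Fin 3) (Fin 3) k}
    {p : MvPolynomial (Fin 3 ⊕ Fin 3) k} (hp : p ∈ reesIdeal a) {m : Fin 3 ⊕ Fin 3 →₀ ℕ}
    (hm : m.degree < 2) : coeff m p = 0 := by
  classical
  have hb (n : Matrix (Fin 3) (Fin 3) k) (r : MvPolynomial (Fin 3 ⊕ Fin 3) k) :
      coeff m (r * bilin n) = 0 := by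
    rw [coeff_mul]
    refine Finset.sum_eq_zero fun x hx => ?_
    rw [Finset.HasAntidiagonal.mem_antidiagonal] at hx
    rw [(isHomogeneous_bilin n).coeff_eq_zero, mul_zero]
    rw [← hx, map_add] at hm
    omega
  obtain ⟨r, s, rfl⟩ := Ideal.mem_span_pair.1 hp
  rw [coeff_add, hb, hb, add_zero]

lemma two_le_totalDegree_of_mem_reesIdeal {a : Matrix (Fin 3) (Fin 3) k}
    {p : MvPolynomial (Fin 3 ⊕ Fin 3) k} (hp : p ∈ reesIdeal a) (hp0 : p ≠ 0) :
    2 ≤ p.totalDegree := by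
  obtain ⟨m, hm⟩ := exists_coeff_ne_zero hp0
  by_contra! h
  exact hm (coeff_eq_zero_of_mem_reesIdeal hp
    ((le_totalDegree (mem_support_iff.2 hm)).trans_lt h))

/-- The two equations have no common factor: the ideal they generate is prime and contains no
non-zero polynomials of degree less than two, so one of the two complementary factors of a
quadratic equation would be constant. -/
lemma isRelPrime_bilin [CharZero k] {a : Matrix (Fin 3) (Fin 3) k} (hsq : Squarefree (cubic a)) :
    IsRelPrime (bilin (traceFree a)) (bilin (traceFree (a ^ 2))) := by
  intro d ⟨q, hq⟩ ⟨r, hr⟩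
  have hind {α β : k} := eq_zero_of_combination_bilin_eq_zero (α := α) (β := β) hsq.ne_zero
  have h1 : bilin (traceFree a) ≠ 0 := fun h => by
    simpa using hind (α := 1) (β := 0) (by simp [h])
  have h2 : bilin (traceFree (a ^ 2)) ≠ 0 := fun h => by
    simpa using hind (α := 0) (β := 1) (by simp [h])
  have hd0 : d ≠ 0 := by rintro rfl; simp at hq; exact h1 hq
  have hq0 : q ≠ 0 := by rintro rfl; simp at hq; exact h1 hq
  have hr0 : r ≠ 0 := by rintro rfl; simp at hr; exact h2 hr
  have hdq : d.totalDegree + q.totalDegree = 2 := by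
    rw [← totalDegree_mul_of_isDomain hd0 hq0, ← hq, (isHomogeneous_bilin _).totalDegree h1]
  have hdr : d.totalDegree + r.totalDegree = 2 := by
    rw [← totalDegree_mul_of_isDomain hd0 hr0, ← hr, (isHomogeneous_bilin _).totalDegree h2]
  have hmem : d * q ∈ reesIdeal a := hq ▸ Ideal.subset_span (by simp)
  rw [← reesParam_eq_zero_iff hsq, map_mul, mul_eq_zero, reesParam_eq_zero_iff hsq,
    reesParam_eq_zero_iff hsq] at hmem
  rcases hmem with hd | hqm
  · have := two_le_totalDegree_of_mem_reesIdeal hd hd0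
    obtain hqC := totalDegree_eq_zero_iff_eq_C.1 (show q.totalDegree = 0 by omega)
    obtain hrC := totalDegree_eq_zero_iff_eq_C.1 (show r.totalDegree = 0 by omega)
    have := hind (α := coeff 0 r) (β := -coeff 0 q) (by
      rw [hq, hr, C_neg, ← hqC, ← hrC]; ring)
    rw [this.1, C_0] at hrC
    exact absurd hrC hr0
  · have := two_le_totalDegree_of_mem_reesIdeal hqm hq0
    have hdC := totalDegree_eq_zero_iff_eq_C.1 (show d.totalDegree = 0 by omega)
    rw [hdC] at hd0 ⊢
    exact (Ne.isUnit fun h => hd0 (by rw [h, C_0])).map C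

/-- The map `reesParam`, with the Rees algebra as its target. -/
noncomputable def reesPresentation (h : Fin 3 → MvPolynomial (Fin 3) k) :
    MvPolynomial (Fin 3 ⊕ Fin 3) k →ₐ[k] reesAlgebra (Ideal.span (Set.range h)) :=
  aeval (Sum.elim (fun i => algebraMap (MvPolynomial (Fin 3) k) _ (X i))
    fun i => toRees _ ⟨h i, Ideal.subset_span ⟨i, rfl⟩⟩)

lemma reesPresentation_apply (h : Fin 3 → MvPolynomial (Fin 3) k)
    (p : MvPolynomial (Fin 3 ⊕ Fin 3) k) :
    reesPresentation h p = symToRees _ (symParam h p) := by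
  have : (reesPresentation h).toRingHom = (symToRees _).toRingHom.comp (symParam h) := by
    refine MvPolynomial.ringHom_ext (fun c => ?_) fun i => ?_
    · simp [symParam, reesPresentation, algHom_C]
      rfl
    · rcases i with i | i <;> simp [symParam, reesPresentation, symToRees]
  exact DFunLike.congr_fun this p

lemma isCompleteIntersection_reesAlgebra [CharZero k] {a : Matrix (Fin 3) (Fin 3) k}
    (hsq : Squarefree (cubic a)) :
    IsCompleteIntersection k (reesAlgebra (jacobianIdeal (cubic a))) := by
  let e : MvPolynomial (Fin 3 ⊕ Fin 3) k ≃ₐ[k] MvPolynomial (Fin (3 + 3)) k :=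
    renameEquiv k finSumFinEquiv
  let π : MvPolynomial (Fin 3 ⊕ Fin 3) k →ₐ[k] reesAlgebra (jacobianIdeal (cubic a)) :=
    reesPresentation fun i => pderiv i (cubic a)
  have hπ : Function.Surjective π := fun s => by
    obtain ⟨t, ht⟩ := symToRees_surjective _ s
    obtain ⟨p, rfl⟩ := symParam_surjective _ t
    exact ⟨p, (reesPresentation_apply _ p).trans ht⟩
  have hker (p : MvPolynomial (Fin 3 ⊕ Fin 3) k) : π p = 0 ↔ p ∈ reesIdeal a := by
    rw [← reesParam_eq_zero_iff hsq, ← symToRees_symParam, ← reesPresentation_apply]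
    exact Subtype.ext_iff
  have h1 : bilin (traceFree a) ≠ 0 := fun h => by
    simpa using eq_zero_of_combination_bilin_eq_zero (α := 1) (β := 0) hsq.ne_zero (by simp [h])
  have hspan : Ideal.span {e (bilin (traceFree a)), e (bilin (traceFree (a ^ 2)))} =
      (reesIdeal a).map e := by
    rw [reesIdeal, Ideal.map_span, Set.image_pair]
  have hmap (q : MvPolynomial (Fin (3 + 3)) k) : q ∈ (reesIdeal a).map e ↔ π (e.symm q) = 0 := by
    rw [hker]
    exact Ideal.mem_map_of_equiv e.toRingEquiv q |>.trans
      ⟨fun ⟨x, hx, hxq⟩ => by rw [← hxq]; simpa using hx, fun h => ⟨_, h, by simp⟩⟩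
  refine ⟨3 + 3, [e (bilin (traceFree a)), e (bilin (traceFree (a ^ 2)))],
    isRegular_pair (by simpa using h1) ?_ ?_, ?_⟩
  · intro d hd1 hd2
    have := isRelPrime_bilin hsq (d := e.symm d) (by simpa using map_dvd e.symm hd1)
      (by simpa using map_dvd e.symm hd2)
    simpa using this
  · rw [hspan, Ideal.ne_top_iff_one, hmap, map_one, hker]
    intro h
    simpa using coeff_eq_zero_of_mem_reesIdeal h (m := 0) (by simp)
  · let ρ := π.comp e.symm.toAlgHom
    have hρ : Function.Surjective ρ := hπ.comp e.symm.surjective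
    have hI : RingHom.ker ρ =
        Ideal.ofList [e (bilin (traceFree a)), e (bilin (traceFree (a ^ 2)))] := by
      have : Ideal.ofList [e (bilin (traceFree a)), e (bilin (traceFree (a ^ 2)))] =
          (reesIdeal a).map e := by
        rw [← hspan]; simp [Ideal.ofList_cons, Ideal.span_insert]
      rw [this]
      ext q
      rw [hmap]
      rfl
    exact ⟨(Ideal.quotientKerAlgEquivOfSurjective hρ).symm.trans
      (Ideal.quotientEquivAlgOfEq k hI)⟩

end CompleteIntersection

/-! ### Derivations of the cubic and their resolution -/

section Derivations

variable {k : Type*} [Field k]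

/-- The syzygies of the partial derivatives are the part of the equations of the Rees algebra that
is linear in `T`. -/
lemma exists_of_sum_mul_pderiv_eq_zero [CharZero k] {a : Matrix (Fin 3) (Fin 3) k}
    (hsq : Squarefree (cubic a)) {g : Fin 3 → MvPolynomial (Fin 3) k}
    (hg : ∑ i, g i * pderiv i (cubic a) = 0) :
    ∃ r s : MvPolynomial (Fin 3) k, ∀ i,
      g i = r * linForm (traceFree a) i + s * linForm (traceFree (a ^ 2)) i := by
  have hmem : ∑ i, rename Sum.inl (g i) * X (Sum.inr i) ∈ reesIdeal a := by
    refine mem_reesIdeal_of_reesParam_eq_zero hsq ?_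
    rw [← symToRees_symParam, symParam_sum]
    simp only [hg]
    have h0 : (⟨0, Ideal.zero_mem _⟩ :
      Ideal.span (Set.range fun i => pderiv i (cubic a))) = 0 := rfl
    rw [h0, map_zero, map_zero]
    rfl
  obtain ⟨r, s, hrs⟩ := Ideal.mem_span_pair.1 hmem
  let ε : MvPolynomial (Fin 3 ⊕ Fin 3) k →ₐ[k] MvPolynomial (Fin 3) k := aeval (Sum.elim X 0)
  have hε (p : MvPolynomial (Fin 3) k) : ε (rename Sum.inl p) = p := by
    simp only [ε, aeval_rename, Sum.elim_comp_inl, aeval_X_left, AlgHom.id_apply]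
  have hεX (i : Fin 3) : ε (X (Sum.inr i)) = 0 := by simp [ε]
  have hpd (i : Fin 3) (p : MvPolynomial (Fin 3) k) :
      pderiv (Sum.inr i : Fin 3 ⊕ Fin 3) (rename Sum.inl p) = 0 := by
    classical
    refine pderiv_eq_zero_of_notMem_vars fun h => ?_
    have := vars_rename _ _ h
    simp at this
  have hlin (i : Fin 3) (g : Fin 3 → MvPolynomial (Fin 3) k) :
      ε (pderiv (Sum.inr i) (∑ l, rename Sum.inl (g l) * X (Sum.inr l))) = g i := by
    simp [Derivation.leibniz, hpd, hε, pderiv_X, Pi.single_apply, apply_ite]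
  have hb (m : Matrix (Fin 3) (Fin 3) k) : ε (bilin m) = 0 := by
    simp [bilin_eq_sum, hεX]
  refine ⟨ε r, ε s, fun i => ?_⟩
  have := congrArg (fun p => ε (pderiv (Sum.inr i) p)) hrs
  simp only [hlin, map_add, Derivation.leibniz, smul_eq_mul, map_mul, hb, zero_mul,
    add_zero] at this
  rw [bilin_eq_sum, bilin_eq_sum, hlin, hlin] at this
  rw [← this]

/-- The module of logarithmic vector fields of the cubic is generated by the columns of the matrix
`(x, a x, a² x)`: subtracting a multiple of the Euler vector field gives a syzygy of the partial
derivatives. -/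
lemma exists_saitoMatrix_mulVec_eq [CharZero k] {a : Matrix (Fin 3) (Fin 3) k}
    (hsq : Squarefree (cubic a)) {h : Fin 3 → MvPolynomial (Fin 3) k}
    (hh : cubic a ∣ ∑ i, h i * pderiv i (cubic a)) :
    ∃ c, (saitoMatrix a).mulVec c = h := by
  obtain ⟨q, hq⟩ := hh
  have heuler := sum_linForm_mul_pderiv_cubic (a := a) (m := 1) (by simp)
  simp only [linForm_one, Matrix.trace_one, Fintype.card_fin, Nat.cast_ofNat] at heuler
  obtain ⟨r, s, hrs⟩ := exists_of_sum_mul_pderiv_eq_zero hsq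
    (g := fun i => C 3 * h i - q * X i) (by
      simp only [sub_mul, mul_assoc, Finset.sum_sub_distrib, ← Finset.mul_sum, hq, heuler]
      ring)
  have h3 : (C 3⁻¹ * C 3 : MvPolynomial (Fin 3) k) = 1 := by
    rw [← C_mul, inv_mul_cancel₀ three_ne_zero, C_1]
  refine ⟨![C 3⁻¹ * (q - C a.trace * r - C (a ^ 2).trace * s), r, s], ?_⟩
  ext1 i
  have := hrs i
  simp only [traceFree, linForm_sub, linForm_smul, linForm_one] at this
  simp only [Matrix.mulVec, dotProduct, Fin.sum_univ_three, saitoMatrix, Matrix.of_apply,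
    Matrix.cons_val_zero, Matrix.cons_val_one, Matrix.cons_val, Fin.val_zero, Fin.val_one,
    Fin.val_two, pow_zero, pow_one, linForm_one]
  linear_combination (-C 3⁻¹) * this + (h i - r * linForm a i - s * linForm (a ^ 2) i) * h3

lemma derivation_hypRing_ext {f : MvPolynomial (Fin 3) k} {D E : HypDer f}
    (h : ∀ i, D (Ideal.Quotient.mk _ (X i)) = E (Ideal.Quotient.mk _ (X i))) : D = E := by
  have : D.compAlgebraMap (MvPolynomial (Fin 3) k) = E.compAlgebraMap (MvPolynomial (Fin 3) k) :=
    derivation_ext h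
  ext x
  obtain ⟨p, rfl⟩ := Ideal.Quotient.mk_surjective x
  exact DFunLike.congr_fun this p

lemma derivation_hypRing_apply {f : MvPolynomial (Fin 3) k} (D : HypDer f)
    {h : Fin 3 → MvPolynomial (Fin 3) k}
    (hh : ∀ i, D (Ideal.Quotient.mk _ (X i)) = Ideal.Quotient.mk _ (h i))
    (p : MvPolynomial (Fin 3) k) :
    D (Ideal.Quotient.mk _ p) = Ideal.Quotient.mk _ (mkDerivation k h p) := by
  have : D.compAlgebraMap (MvPolynomial (Fin 3) k) =
      (Algebra.linearMap (MvPolynomial (Fin 3) k) (HypRing f)).compDer (mkDerivation k h) :=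
    derivation_ext fun i => by simpa using hh i
  exact DFunLike.congr_fun this p

lemma mk_mkDerivation_eq_zero {f : MvPolynomial (Fin 3) k} {h : Fin 3 → MvPolynomial (Fin 3) k}
    (hh : f ∣ mkDerivation k h f) (x : MvPolynomial (Fin 3) k)
    (hx : Ideal.Quotient.mkₐ k (Ideal.span {f}) x = 0) :
    Ideal.Quotient.mkₐ k (Ideal.span {f}) (mkDerivation k h x) = 0 := by
  rw [Ideal.Quotient.mkₐ_eq_mk, Ideal.Quotient.eq_zero_iff_mem, Ideal.mem_span_singleton] at hx ⊢
  obtain ⟨y, rfl⟩ := hx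
  rw [Derivation.leibniz, smul_eq_mul, smul_eq_mul]
  exact dvd_add (dvd_mul_right _ _) (hh.mul_left y)

/-- The derivation of `R / (f)` that is induced by a logarithmic vector field with coefficients
`h`. -/
noncomputable def hypDerOf (f : MvPolynomial (Fin 3) k) (h : Fin 3 → MvPolynomial (Fin 3) k)
    (hh : f ∣ mkDerivation k h f) : HypDer f :=
  Derivation.liftOfSurjective (Ideal.Quotient.mkₐ_surjective k (Ideal.span {f}))
    (mk_mkDerivation_eq_zero hh)

lemma hypDerOf_mk (f : MvPolynomial (Fin 3) k) (h : Fin 3 → MvPolynomial (Fin 3) k)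
    (hh : f ∣ mkDerivation k h f) (p : MvPolynomial (Fin 3) k) :
    hypDerOf f h hh (Ideal.Quotient.mk _ p) = Ideal.Quotient.mk _ (mkDerivation k h p) :=
  Derivation.liftOfSurjective_apply (Ideal.Quotient.mkₐ_surjective k (Ideal.span {f}))
    (mk_mkDerivation_eq_zero hh) p

lemma cubic_dvd_mkDerivation (a : Matrix (Fin 3) (Fin 3) k) (j : Fin 3) :
    cubic a ∣ mkDerivation k (fun i => saitoMatrix a i j) (cubic a) := by
  rw [← sum_mul_pderiv]
  have := sum_linForm_mul_pderiv_cubic (a := a) (m := a ^ (j : ℕ)) (pow_mul_comm' a j)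
  exact Dvd.intro_left _ this.symm

/-- The surjection `R³ → Der_k(R/(f))` given by the vector fields `x`, `a x` and `a² x`. -/
noncomputable def derAug (a : Matrix (Fin 3) (Fin 3) k) :
    (Fin 3 → MvPolynomial (Fin 3) k) →ₗ[MvPolynomial (Fin 3) k] HypDer (cubic a) :=
  Fintype.linearCombination (MvPolynomial (Fin 3) k) fun j =>
    hypDerOf (cubic a) (fun i => saitoMatrix a i j) (cubic_dvd_mkDerivation a j)

lemma derAug_apply (a : Matrix (Fin 3) (Fin 3) k) (c : Fin 3 → MvPolynomial (Fin 3) k)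
    (i : Fin 3) : derAug a c (Ideal.Quotient.mk _ (X i)) =
      Ideal.Quotient.mk _ ((saitoMatrix a).mulVec c i) := by
  simp only [derAug, Fintype.linearCombination_apply, Fin.sum_univ_three, Derivation.add_apply,
    Derivation.smul_apply, hypDerOf_mk, mkDerivation_X, Matrix.mulVec, dotProduct]
  have hsmul (r s : MvPolynomial (Fin 3) k) : r • Ideal.Quotient.mk (Ideal.span {cubic a}) s =
      Ideal.Quotient.mk _ (s * r) := by rw [mul_comm]; rfl
  rw [hsmul, hsmul, hsmul, ← map_add, ← map_add]

lemma derAug_surjective [CharZero k] {a : Matrix (Fin 3) (Fin 3) k}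
    (hsq : Squarefree (cubic a)) : Function.Surjective (derAug a) := by
  intro D
  choose h hh using fun i => Ideal.Quotient.mk_surjective (D (Ideal.Quotient.mk _ (X i)))
  have hf := derivation_hypRing_apply D (fun i => (hh i).symm) (cubic a)
  rw [Ideal.Quotient.mk_singleton_self, map_zero, eq_comm, Ideal.Quotient.eq_zero_iff_mem,
    Ideal.mem_span_singleton, ← sum_mul_pderiv] at hf
  obtain ⟨c, rfl⟩ := exists_saitoMatrix_mulVec_eq hsq hf
  exact ⟨c, derivation_hypRing_ext fun i => by rw [derAug_apply, hh]⟩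

lemma cubic_dvd_iff [CharZero k] {a : Matrix (Fin 3) (Fin 3) k}
    {p : MvPolynomial (Fin 3) k} : cubic a ∣ p ↔ (saitoMatrix a).det ∣ p := by
  have : IsUnit (-2 : MvPolynomial (Fin 3) k) := by
    have : IsUnit (C (-2 : k) : MvPolynomial (Fin 3) k) :=
      (Ne.isUnit (neg_ne_zero.2 two_ne_zero)).map C
    rwa [C_neg, map_ofNat] at this
  rw [cubic_eq, this.mul_left_dvd]

/-- The relations between the three generators are given by the adjugate matrix: by Cramer's rule
its columns express the vector fields `f ∂/∂x_i`, up to a constant. -/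
lemma exact_adjugate_derAug [CharZero k] {a : Matrix (Fin 3) (Fin 3) k} (h0 : cubic a ≠ 0) :
    Function.Exact (Matrix.toLin' (saitoMatrix a).adjugate) (derAug a) := by
  have hdet : (saitoMatrix a).det ≠ 0 := fun h => h0 (by rw [cubic_eq, h, mul_zero])
  intro c
  have hc : derAug a c = 0 ↔ ∀ i, (saitoMatrix a).det ∣ (saitoMatrix a).mulVec c i := by
    have hi (i : Fin 3) : (saitoMatrix a).det ∣ (saitoMatrix a).mulVec c i ↔
        derAug a c (Ideal.Quotient.mk _ (X i)) = 0 := by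
      rw [derAug_apply, Ideal.Quotient.eq_zero_iff_mem, Ideal.mem_span_singleton, cubic_dvd_iff]
    simp only [hi]
    exact ⟨fun h i => by rw [h]; rfl, fun h => derivation_hypRing_ext h⟩
  rw [hc]
  constructor
  · intro h
    choose w hw using h
    refine ⟨w, ?_⟩
    rw [Matrix.toLin'_apply]
    refine sub_eq_zero.1 (Matrix.eq_zero_of_mulVec_eq_zero hdet ?_)
    rw [Matrix.mulVec_sub, Matrix.mulVec_mulVec, Matrix.mul_adjugate, Matrix.smul_mulVec,
      Matrix.one_mulVec, sub_eq_zero]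
    ext1 i
    rw [hw]
    rfl
  · rintro ⟨w, rfl⟩ i
    rw [Matrix.toLin'_apply, Matrix.mulVec_mulVec, Matrix.mul_adjugate, Matrix.smul_mulVec,
      Matrix.one_mulVec]
    exact dvd_mul_right _ _

lemma adjugate_mulVec_injective {a : Matrix (Fin 3) (Fin 3) k} (h0 : cubic a ≠ 0) :
    Function.Injective (Matrix.toLin' (saitoMatrix a).adjugate) := by
  have hdet : (saitoMatrix a).det ≠ 0 := fun h => h0 (by rw [cubic_eq, h, mul_zero])
  refine (injective_iff_map_eq_zero _).2 fun c hc => ?_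
  rw [Matrix.toLin'_apply] at hc
  refine Matrix.eq_zero_of_mulVec_eq_zero ?_ hc
  rw [Matrix.det_adjugate]
  exact pow_ne_zero _ hdet

lemma mem_homogPart_of_isHomogeneous {σ : Type*} {p : MvPolynomial σ k} {n : ℕ}
    (hp : p.IsHomogeneous n) : p ∈ homogPart σ k n := by
  intro m hm
  by_contra h
  exact hm (hp.coeff_eq_zero fun h' => h (by rw [h']))

lemma isHomogeneous_linForm (a : Matrix (Fin 3) (Fin 3) k) (i : Fin 3) :
    (linForm a i).IsHomogeneous 1 :=
  IsHomogeneous.sum _ _ _ fun j _ => by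
    simpa using (isHomogeneous_C _ (a i j)).mul (isHomogeneous_X k j)

lemma isHomogeneous_adjugate (a : Matrix (Fin 3) (Fin 3) k) (i j : Fin 3) :
    ((saitoMatrix a).adjugate i j).IsHomogeneous 2 := by
  have h (i j i' j' l m l' m' : Fin 3) :
      (saitoMatrix a i j * saitoMatrix a i' j' -
        saitoMatrix a l m * saitoMatrix a l' m').IsHomogeneous 2 :=
    ((isHomogeneous_linForm _ _).mul (isHomogeneous_linForm _ _)).sub
      ((isHomogeneous_linForm _ _).mul (isHomogeneous_linForm _ _))
  rw [Matrix.adjugate_fin_three]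
  fin_cases i <;> fin_cases j <;> simp [neg_add_eq_sub, h]

/-- The ranks of the free modules in the resolution of the module of derivations. -/
def derRank : ℕ → ℕ
  | 0 => 3
  | 1 => 3
  | _ + 2 => 0

/-- The differentials of the resolution of the module of derivations. -/
noncomputable def derDiff (a : Matrix (Fin 3) (Fin 3) k) : (i : ℕ) →
    (Fin (derRank (i + 1)) → MvPolynomial (Fin 3) k) →ₗ[MvPolynomial (Fin 3) k]
      (Fin (derRank i) → MvPolynomial (Fin 3) k)
  | 0 => Matrix.toLin' (saitoMatrix a).adjugate
  | _ + 1 => 0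

/-- The resolution `0 → R(-2)³ → R³ → Der_k(R/(f)) → 0`. -/
noncomputable def derResolution [CharZero k] {a : Matrix (Fin 3) (Fin 3) k}
    (hsq : Squarefree (cubic a)) :
    MinimalGradedFreeResolution (σ := Fin 3) (HypDer (cubic a)) (derGrading (cubic a)) where
  length := 1
  rank := derRank
  shift i _ := 2 * i
  d := derDiff a
  aug := derAug a
  rank_eq_zero i hi := by
    obtain ⟨n, rfl⟩ := Nat.exists_eq_add_of_le' hi
    rfl
  aug_surjective := derAug_surjective hsq
  exact_aug := exact_adjugate_derAug hsq.ne_zero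
  exact_d i := by
    cases i with
    | zero =>
      intro x
      refine ⟨fun h => ⟨0, ?_⟩, ?_⟩
      · rw [map_zero]
        exact (adjugate_mulVec_injective hsq.ne_zero (h.trans (map_zero _).symm)).symm
      · rintro ⟨y, rfl⟩
        exact map_zero _
    | succ i =>
      intro x
      have : x = 0 := funext fun j => Fin.elim0 j
      subst this
      exact ⟨fun _ => ⟨0, map_zero _⟩, fun _ => map_zero _⟩
  aug_homogeneous j i := by
    refine ⟨saitoMatrix a i j, mem_homogPart_of_isHomogeneous (isHomogeneous_linForm _ _), ?_⟩
    refine Eq.trans ?_ (derAug_apply a _ i).symm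
    exact congrArg (Ideal.Quotient.mk _)
      (congrFun (Matrix.mulVec_single_one (saitoMatrix a) j) i).symm
  d_homogeneous i j l := by
    cases i with
    | zero =>
      have : derDiff a 0 (Pi.single j 1) l = (saitoMatrix a).adjugate l j := by
        exact congrFun (Matrix.mulVec_single_one _ j) l
      rw [this]
      exact mem_homogPart_of_isHomogeneous (isHomogeneous_adjugate a l j)
    | succ i => exact Fin.elim0 j
  minimal i j l := by
    cases i with
    | zero =>
      have : derDiff a 0 (Pi.single j 1) l = (saitoMatrix a).adjugate l j := by
        exact congrFun (Matrix.mulVec_single_one _ j) l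
      rw [this]
      exact (isHomogeneous_adjugate a l j).coeff_eq_zero (by simp)
    | succ i => exact Fin.elim0 j

lemma hasRegularity_hypDer [CharZero k] {a : Matrix (Fin 3) (Fin 3) k}
    (hsq : Squarefree (cubic a)) :
    HasRegularity (σ := Fin 3) (HypDer (cubic a)) (derGrading (cubic a)) 1 := by
  refine ⟨derResolution hsq, ⟨1, (0 : Fin 3), by simp [derResolution]⟩, ?_⟩
  rintro _ ⟨i, j, rfl⟩
  match i, j with
  | 0, j => simp [derResolution]
  | 1, j => simp [derResolution]
  | i + 2, j => exact Fin.elim0 j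

end Derivations

end FreeDiv

theorem proposition5p3 {k : Type*} [Field k] [CharZero k] (a : Matrix (Fin 3) (Fin 3) k)
    (f : MvPolynomial (Fin 3) k) (hf : f = FreeDiv.cubic a) (hf0 : f ≠ 0)
    (hred : Squarefree f) :
    (FreeDiv.IsLinearType (FreeDiv.jacobianIdeal f) ∧
      FreeDiv.reductionNumber (FreeDiv.jacobianIdeal f) = 0) ∧
    (Nonempty (reesAlgebra (FreeDiv.jacobianIdeal f) ≃ₐ[MvPolynomial (Fin 3) k]
        SymmetricAlgebra (MvPolynomial (Fin 3) k) (FreeDiv.jacobianIdeal f)) ∧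
      FreeDiv.IsCompleteIntersection k (reesAlgebra (FreeDiv.jacobianIdeal f))) ∧
    FreeDiv.HasRegularity (σ := Fin 3) (FreeDiv.HypDer f) (FreeDiv.derGrading f) 1 := by
  subst hf
  have hlin := FreeDiv.isLinearType_jacobianIdeal hred
  exact ⟨⟨hlin, FreeDiv.reductionNumber_eq_zero_of_isLinearType
      (Submodule.fg_span (Set.finite_range _)) hlin⟩,
    ⟨⟨(AlgEquiv.ofBijective (FreeDiv.symToRees _) hlin).symm⟩,
      FreeDiv.isCompleteIntersection_reesAlgebra hred⟩,
    FreeDiv.hasRegularity_hypDer hred⟩
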